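/- Let $V$ be a countable set with a distinguished vertex $0$ (the origin), and let $p(x,y)\ge 0$, $x,y\in V$, be symmetric irreducible rates with $\sup_x\sum_y p(x,y)<\infty$. Let $(X_t)$ be the continuous-time random walk on $V$ jumping from $x$ to $y$ at rate $p(x,y)$. It is recurrent if, started at any $x$, it almost surely visits $x$ at arbitrarily large times, and transient if, started at any $x$, the set of times spent at $x$ is almost surely bounded. Write $\mathbb E^{RW}_x$ for expectation of the walk started at $x$, $\mathbb E^{IRW}_{x,y}$ for two independent walks $X_s,Y_s$ started at $x,y$, and, for $x\neq y$, $\mathbb E^{SEP}_{x,y}$ for the two labeled particles $x(s),y(s)$ of the symmetric exclusion process started at $x,y$ (each particle jumps with the rates $p$, jumps to the occupied site being suppressed). Let $\delta_{\cdot,\cdot}$ be the Kronecker symbol, with the convention $e^{-\infty}=0$. On $\Omega=\{0,1\}^V$ let $\eta^{x,y}$ be $\eta$ with the particle at $x$ moved to $y$ (if $\eta_x=1$, $\eta_y=0$), let $\eta^0$ be $\eta$ with the occupation at the origin flipped, and for local $f$ put $$L f(\eta)=\sum_{x,y}p(x,y)\,\eta_x(1-\eta_y)\,(f(\eta^{x,y})-f(\eta)).$$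 For $\lambda\ge 0$ the process with source has generator $L_0f(\eta)=Lf(\eta)+\lambda(1-\eta_0)(f(\eta^0)-f(\eta))$ and Feller semigroup $S_0(t)$. For $\lambda\ge0$, $\mu>0$ the process with source and sink has generator $L_1f(\eta)=L_0f(\eta)+\mu\,\eta_0(f(\eta^0)-f(\eta))$ and Feller semigroup $S_1(t)$. Let $\nu_\rho$, $\rho\in[0,1]$, be the product Bernoulli measure of density $\rho$, $\rho_R=\lambda/(\lambda+\mu)$, $\delta_\eta$ the Dirac measure at $\eta$, and $\underline 1$ the fully occupied configuration. Limits of measures are weak limits. **I) Source only.** 1. If the walk is recurrent and $\lambda>0$, then $\lim_{t\to\infty}\nu_\rho S_0(t)=\delta_{\underline 1}$, and $\lim_{t\to\infty}\delta_\eta S_0(t)=\delta_{\underline 1}$ for every $\eta\in\Omega$. Moreover, $\delta_{\underline 1}$ is the unique invariant probability measure. 2. If the walk is transient, then $\mu_{\rho,0}=\lim_{t\to\infty}\nu_\rho S_0(t)$ exists, for all $x\in V$ $$\lim_{t\to\infty}\int(1-\eta_x)\,d(\nu_\rho S_0(t))=\int(1-\eta_x)\,d\mu_{\rho,0}=(1-\rho)\,\mathbb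 E^{RW}_x e^{-\lambda\int_0^\infty\delta_{X_s,0}ds},$$ and for all $x\ne y$ in $V$ $$\mathrm{cov}_{\mu_{\rho,0}}(\eta_x,\eta_y)=(1-\rho)^2\Big(\mathbb E^{SEP}_{x,y}e^{-\lambda\int_0^\infty(\delta_{x(s),0}+\delta_{y(s),0})ds}-\mathbb E^{IRW}_{x,y}e^{-\lambda\int_0^\infty(\delta_{X_s,0}+\delta_{Y_s,0})ds}\Big).$$ **II) Source and sink.** 1. If the walk is recurrent, then $\lim_{t\to\infty}\nu_\rho S_1(t)=\nu_{\rho_R}$, and $\lim_{t\to\infty}\delta_\eta S_1(t)=\nu_{\rho_R}$ for every $\eta\in\Omega$. 2. If the walk is transient, then $\mu_{\rho,1}=\lim_{t\to\infty}\nu_\rho S_1(t)$ exists, for all $x\in V$ $$\lim_{t\to\infty}\int\eta_x\,d(\nu_\rho S_1(t))=\int\eta_x\,d\mu_{\rho,1}=\rho_R+(\rho-\rho_R)\,\mathbb E^{RW}_x e^{-(\lambda+\mu)\int_0^\infty\delta_{X_s,0}ds},$$ and for all $x\ne y$ in $V$ $$\mathrm{cov}_{\mu_{\rho,1}}(\eta_x,\eta_y)=(\rho-\rho_R)^2\Big(\mathbb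 E^{SEP}_{x,y}e^{-(\lambda+\mu)\int_0^\infty(\delta_{x(s),0}+\delta_{y(s),0})ds}-\mathbb E^{IRW}_{x,y}e^{-(\lambda+\mu)\int_0^\infty(\delta_{X_s,0}+\delta_{Y_s,0})ds}\Big).$$ -/

import Mathlib

open MeasureTheory ProbabilityTheory Filter Topology
open scoped NNReal ENNReal

noncomputable section

namespace SourceSink

/-! ### Rates on a countable vertex set -/

section Rates

variable {V : Type*}

/-- The `n`-step rates `p⁽ⁿ⁾(x, y)`, with the convention `p⁽⁰⁾(x, y) = 1_{x = y}`. -/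
def nStepRate [DecidableEq V] (p : V → V → ℝ≥0) : ℕ → V → V → ℝ≥0∞
  | 0, x, y => if x = y then 1 else 0
  | n + 1, x, y => ∑' z, (p x z : ℝ≥0∞) * nStepRate p n z y

/-- Irreducible symmetric rates with uniformly bounded total rate. -/
structure IsWalkRates [DecidableEq V] (p : V → V → ℝ≥0) : Prop where
  symm : ∀ x y, p x y = p y x
  irreducible : ∀ x y, ∃ n, 0 < nStepRate p n x y
  bounded : ⨆ x, ∑' y, (p x y : ℝ≥0∞) < ∞

end Rates

/-! ### Continuous-time Markov chains on a countable state space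

The minimal chain with jump rates `q x y` is realized by its jump chain and holding times: the
sample space is `(ℕ → S) × (ℕ → ℝ)`, the first component is the discrete jump chain, and the
second one is an independent i.i.d. sequence of standard exponential variables; the holding time
in the `n`-th visited state `Y n` is the `n`-th exponential variable divided by the total rate
of `Y n` (infinite if this rate is `0`). -/

section JumpProcess

variable {S : Type*}

/-- Total jump rate out of `x`. -/
def totalRate (q : S → S → ℝ≥0) (x : S) : ℝ≥0∞ := ∑' y, (q x y : ℝ≥0∞)

open Classical in
/-- One step of the jump chain: from `x` to `y` with probability `q x y / totalRate q x`; stay at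
`x` if the total rate is `0` (the total rates are always finite below). -/
def jumpStep (q : S → S → ℝ≥0) (x : S) : PMF S :=
  if h : totalRate q x ≠ 0 ∧ totalRate q x ≠ ∞ then
    PMF.normalize (fun y => (q x y : ℝ≥0∞)) h.1 h.2
  else PMF.pure x

/-- Sample space: jump chain and standard exponential clocks. -/
abbrev Sample (S : Type*) : Type _ := (ℕ → S) × (ℕ → ℝ)

/-- The time of the `n`-th jump. -/
def jumpTime (q : S → S → ℝ≥0) (ω : Sample S) (n : ℕ) : ℝ≥0∞ :=
  ∑ k ∈ Finset.range n, ENNReal.ofReal (ω.2 k) / totalRate q (ω.1 k)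

/-- The state at time `t`: the state entered at the last jump not later than `t`. -/
def position (q : S → S → ℝ≥0) (t : ℝ) (ω : Sample S) : S :=
  ω.1 (sSup {n : ℕ | jumpTime q ω n ≤ ENNReal.ofReal t})

variable [Countable S] [MeasurableSpace S] [MeasurableSingletonClass S]

/-- Transition kernel of the jump chain. -/
def jumpKernel (q : S → S → ℝ≥0) : Kernel S S :=
  Kernel.ofFunOfCountable fun x => (jumpStep q x).toMeasure

instance (q : S → S → ℝ≥0) : IsMarkovKernel (jumpKernel q) :=
  ⟨fun x => PMF.toMeasure.isProbabilityMeasure (jumpStep q x)⟩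

/-- The jump-chain kernel as a function of the whole history up to time `n`. -/
def historyKernel (q : S → S → ℝ≥0) (n : ℕ) : Kernel ((_ : Finset.Iic n) → S) S :=
  (jumpKernel q).comap (fun h => h ⟨n, Finset.mem_Iic.2 le_rfl⟩) (measurable_pi_apply _)

instance (q : S → S → ℝ≥0) (n : ℕ) : IsMarkovKernel (historyKernel q n) := by
  unfold historyKernel; infer_instance

/-- Law of the jump chain started at `x`. -/
def jumpChainLaw (q : S → S → ℝ≥0) (x : S) : Measure (ℕ → S) :=
  Kernel.traj (X := fun _ => S) (historyKernel q) 0 (fun _ => x)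

/-- Law `ℙ_x` of the continuous-time chain with rates `q` started at `x`. -/
def chainLaw (q : S → S → ℝ≥0) (x : S) : Measure (Sample S) :=
  (jumpChainLaw q x).prod (Measure.infinitePi fun _ : ℕ => expMeasure 1)

/-- Every state is visited at arbitrarily large times, almost surely, by the chain started there. -/
def IsRecurrent (q : S → S → ℝ≥0) : Prop :=
  ∀ x, ∀ᵐ ω ∂(chainLaw q x), ¬ BddAbove {t : ℝ | 0 ≤ t ∧ position q t ω = x}

/-- The set of times at which the starting state is visited is bounded, almost surely. -/
def IsTransient (q : S → S → ℝ≥0) : Prop :=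
  ∀ x, ∀ᵐ ω ∂(chainLaw q x), BddAbove {t : ℝ | 0 ≤ t ∧ position q t ω = x}

end JumpProcess

/-! ### Feynman–Kac functionals -/

section FeynmanKac

/-- `e^{-a}` for `a ∈ [0, ∞]`, with `e^{-∞} = 0`. -/
def expNeg (a : ℝ≥0∞) : ℝ := if a = ∞ then 0 else Real.exp (-a.toReal)

variable {V : Type*} [DecidableEq V]

/-- Kronecker symbol. -/
def kron (x y : V) : ℝ≥0∞ := if x = y then 1 else 0

/-- Rates of the labeled symmetric exclusion process with two particles: each particle jumps
from `x` to `y` at rate `p x y`, provided that `y` is empty. -/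
def exclusionPairRate (p : V → V → ℝ≥0) (a b : V × V) : ℝ≥0 :=
  (if b.2 = a.2 ∧ b.1 ≠ a.1 ∧ b.1 ≠ a.2 then p a.1 b.1 else 0) +
    (if b.1 = a.1 ∧ b.2 ≠ a.2 ∧ b.2 ≠ a.1 then p a.2 b.2 else 0)

variable [Countable V] [MeasurableSpace V] [MeasurableSingletonClass V]

/-- `𝔼ᴿᵂ_x exp(-c ∫₀^∞ δ_{X_s, o} ds)`. -/
def walkFK (p : V → V → ℝ≥0) (o : V) (c : ℝ≥0) (x : V) : ℝ :=
  ∫ ω, expNeg (c * ∫⁻ s in Set.Ioi (0 : ℝ), kron (position p s ω) o) ∂(chainLaw p x)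

/-- `𝔼ˢᴱᴾ_{x,y} exp(-c ∫₀^∞ (δ_{x(s), o} + δ_{y(s), o}) ds)`. -/
def exclusionFK (p : V → V → ℝ≥0) (o : V) (c : ℝ≥0) (x y : V) : ℝ :=
  ∫ ω, expNeg (c * ∫⁻ s in Set.Ioi (0 : ℝ),
      (kron (position (exclusionPairRate p) s ω).1 o +
        kron (position (exclusionPairRate p) s ω).2 o))
    ∂(chainLaw (exclusionPairRate p) (x, y))

/-- `𝔼ᴵᴿᵂ_{x,y} exp(-c ∫₀^∞ (δ_{X_s, o} + δ_{Y_s, o}) ds)` for two independent walks. -/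
def independentFK (p : V → V → ℝ≥0) (o : V) (c : ℝ≥0) (x y : V) : ℝ :=
  ∫ ω, expNeg (c * ∫⁻ s in Set.Ioi (0 : ℝ),
      (kron (position p s ω.1) o + kron (position p s ω.2) o))
    ∂((chainLaw p x).prod (chainLaw p y))

end FeynmanKac

/-! ### Feller semigroups and their generators -/

/-- A Feller (Markov) semigroup on a compact space, given by its transition kernels. -/
structure FellerSemigroup (E : Type*) [TopologicalSpace E] [MeasurableSpace E] where
  kernel : ℝ≥0 → Kernel E E
  markov : ∀ t, IsMarkovKernel (kernel t)
  kernel_zero : kernel 0 = Kernel.id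
  kernel_add : ∀ s t, kernel (s + t) = kernel t ∘ₖ kernel s
  feller : ∀ (t : ℝ≥0) (f : C(E, ℝ)), Continuous fun x => ∫ y, f y ∂(kernel t x)
  strongly_continuous : ∀ f : C(E, ℝ),
    TendstoUniformly (fun (t : ℝ≥0) x => ∫ y, f y ∂(kernel t x)) f (𝓝[>] 0)

/-- The law `π S(t)` at time `t` of the process started from `π`. -/
def FellerSemigroup.evolve {E : Type*} [TopologicalSpace E] [MeasurableSpace E]
    (T : FellerSemigroup E) (π : ProbabilityMeasure E) (t : ℝ≥0) : ProbabilityMeasure E :=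
  ⟨T.kernel t ∘ₘ (π : Measure E), by
    have := T.markov t
    infer_instance⟩

/-! ### Exclusion process with a source, or with a source and a sink -/

section Exclusion

/-- Configurations `η ∈ {0,1}^V`; `η x = true` means that `x` is occupied. -/
abbrev Config (V : Type*) : Type _ := V → Bool

variable {V : Type*}

/-- The occupation variable `η_x ∈ {0, 1}`. -/
def occ (η : Config V) (x : V) : ℝ := if η x = true then 1 else 0

/-- A function that depends on finitely many coordinates only. -/
def IsLocal (f : Config V → ℝ) : Prop := ∃ A : Finset V, DependsOn f (A : Set V)

variable [DecidableEq V]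

/-- `η^{x,y}`: the particle at `x` is moved to `y` if `x` is occupied and `y` is empty. -/
def moveParticle (η : Config V) (x y : V) : Config V :=
  if η x = true ∧ η y = false then Function.update (Function.update η x false) y true else η

/-- The configuration with the occupation at `o` flipped. -/
def flipAt (η : Config V) (o : V) : Config V := Function.update η o (!(η o))

/-- Generator of the symmetric exclusion process. -/
def exclusionGen (p : V → V → ℝ≥0) (f : Config V → ℝ) (η : Config V) : ℝ :=
  ∑' e : V × V, (p e.1 e.2 : ℝ) * (occ η e.1 * (1 - occ η e.2)) *
    (f (moveParticle η e.1 e.2) - f η)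

/-- Generator of the exclusion process with a source of intensity `lam` at `o`. -/
def sourceGen (p : V → V → ℝ≥0) (o : V) (lam : ℝ≥0) (f : Config V → ℝ) (η : Config V) : ℝ :=
  exclusionGen p f η + (lam : ℝ) * (1 - occ η o) * (f (flipAt η o) - f η)

/-- Generator of the exclusion process with a source of intensity `lam` and a sink of intensity
`mu` at `o`. -/
def sourceSinkGen (p : V → V → ℝ≥0) (o : V) (lam mu : ℝ≥0) (f : Config V → ℝ)
    (η : Config V) : ℝ :=
  exclusionGen p f η + (lam : ℝ) * (1 - occ η o) * (f (flipAt η o) - f η) +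
    (mu : ℝ) * occ η o * (f (flipAt η o) - f η)

/-- `T` is the semigroup of the process with generator `L` (given on local functions):
`(T(t) f - f) / t → L f` uniformly as `t ↓ 0`, for every local `f`. -/
def HasGenerator (T : FellerSemigroup (Config V)) (L : (Config V → ℝ) → Config V → ℝ) : Prop :=
  ∀ f, IsLocal f →
    TendstoUniformly (fun (t : ℝ≥0) η => ((∫ ζ, f ζ ∂(T.kernel t η)) - f η) / (t : ℝ))
      (L f) (𝓝[>] 0)

/-- The homogeneous Bernoulli product measure `ν_ρ`. -/
def bernoulliProduct (V : Type*) (ρ : unitInterval) : ProbabilityMeasure (Config V) :=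
  ⟨Measure.infinitePi fun _ : V => bernoulliMeasure true false ρ, inferInstance⟩

/-- The Dirac measure at a configuration. -/
def diracConfig (η : Config V) : ProbabilityMeasure (Config V) := ⟨Measure.dirac η, inferInstance⟩

/-- The fully occupied configuration. -/
def fullConfig (V : Type*) : Config V := fun _ => true

/-- The reservoir density `λ / (λ + μ)`. -/
def reservoirDensity (lam mu : ℝ≥0) : unitInterval :=
  ⟨(lam : ℝ) / ((lam : ℝ) + mu), div_nonneg lam.2 (add_nonneg lam.2 mu.2),
    div_le_one_of_le₀ (le_add_of_nonneg_right mu.2) (add_nonneg lam.2 mu.2)⟩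

end Exclusion

end SourceSink

end

/-! Both processes are symmetric exclusion coupled at the origin to a reservoir of density θ and
total intensity c: θ = 1, c = λ for the source alone, θ = ρ_R, c = λ + μ for source and sink. The
tool is duality with D_A(η) = ∏_{x ∈ A} (η_x - θ). Symmetry of p makes exclusion act on D_A by
moving the set A as an exclusion process (`exclusionGen_dual`), and centring at θ turns the flips at
the origin into killing at rate c while A contains the origin (`reservoirGen_dual`). Hence t ↦ E
D_A(η_t) solves, for each value of |A| separately, a closed linear equation with bounded rates
(`isFlow_expectAt_dual`).

Under ν_ρ the initial datum is the constant (ρ - θ)^|A|. By the maximum principle the solution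
converges to this constant times the largest harmonic function bounded by 1, which is the
probability that the dual particles are never killed (`IsFlow.tendsto`). The integrals of the D_A
determine a law, and the space of laws is compact, so weak convergence follows. The one- and
two-particle survival probabilities are Feynman–Kac functionals (`integral_expNeg_eq_survivalLim`);
the unlabeled pair is the labeled one with its labels forgotten (`survivalLim_pair`). The covariance
of η_x and η_y is the expectation of D_{x,y} minus the product of those of D_{x} and D_{y}, and the
independent functional factorizes, which gives the covariance formulas.

If the walk is recurrent, it passes the origin infinitely often and the one-particle survival
probability is 0 (`survivalLim_eq_zero`). For an arbitrary initial law, let v be the one-particle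
solution started from 1. Then ∑_{x ∈ A} v_t(x) dominates |E D_A(η_t)|, because exclusion is
invisible to sums over particles (`tsum_moveRate_sum`). So all expectations with A nonempty vanish
in the limit, which characterizes ν_θ; for θ = 1 this is the Dirac mass at the full configuration.
-/

namespace SourceSink

/-! ### Linear evolution equations with bounded jump rates and killing -/

section Evolution

variable {S J : Type*}

/-- The operator `f ↦ ∑ j, a x j * (f (τ x j) - f x) - k x * f x`: jumps from `x` to `τ x j` at
rate `a x j` and killing at rate `k x`. -/
noncomputable def rateOp (a : S → J → ℝ) (τ : S → J → S) (k : S → ℝ) (f : S → ℝ) (x : S) : ℝ :=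
  ∑' j, a x j * (f (τ x j) - f x) - k x * f x

/-- Nonnegative jump rates with total rate at most `R`. -/
structure IsBoundedRates (a : S → J → ℝ) (R : ℝ) : Prop where
  nonneg : ∀ x j, 0 ≤ a x j
  summable : ∀ x, Summable (a x)
  tsum_le : ∀ x, ∑' j, a x j ≤ R

/-- Bounded solutions of `u' = rateOp a τ k u` on `[0, ∞)` (with right derivatives). -/
structure IsFlow (a : S → J → ℝ) (τ : S → J → S) (k : S → ℝ) (u : ℝ → S → ℝ) : Prop where
  bounded : ∃ C, ∀ t, 0 ≤ t → ∀ x, |u t x| ≤ C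
  continuousOn : ∀ x, ContinuousOn (fun t => u t x) (Set.Ici 0)
  deriv : ∀ t, 0 ≤ t → ∀ x,
    HasDerivWithinAt (fun t => u t x) (rateOp a τ k (u t) x) (Set.Ici t) t

variable {a : S → J → ℝ} {τ : S → J → S} {k : S → ℝ} {R : ℝ}

lemma IsBoundedRates.summable_mul (ha : IsBoundedRates a R) {g : J → ℝ} {C : ℝ}
    (hg : ∀ j, |g j| ≤ C) (x : S) : Summable fun j => a x j * g j := by
  refine Summable.of_norm_bounded ((ha.summable x).mul_right C) fun j => ?_
  rw [Real.norm_eq_abs, abs_mul, abs_of_nonneg (ha.nonneg x j)]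
  exact mul_le_mul_of_nonneg_left (hg j) (ha.nonneg x j)

lemma rateOp_eq (ha : IsBoundedRates a R) {f : S → ℝ} {C : ℝ} (hf : ∀ x, |f x| ≤ C) (x : S) :
    rateOp a τ k f x = ∑' j, a x j * f (τ x j) - (∑' j, a x j + k x) * f x := by
  have h1 := ha.summable_mul (fun j => hf (τ x j)) x
  have h2 := (ha.summable x).mul_right (f x)
  simp only [rateOp, mul_sub]
  rw [h1.tsum_sub h2, tsum_mul_right]
  ring

lemma rateOp_linear (ha : IsBoundedRates a R) {f g : S → ℝ} {C D : ℝ} (hf : ∀ x, |f x| ≤ C)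
    (hg : ∀ x, |g x| ≤ D) (b c : ℝ) (x : S) :
    rateOp a τ k (fun y => b * f y + c * g y) x = b * rateOp a τ k f x + c * rateOp a τ k g x := by
  have h1 := ha.summable_mul (g := fun j => f (τ x j) - f x) (C := C + C)
    (fun j => (abs_sub _ _).trans (add_le_add (hf _) (hf _))) x
  have h2 := ha.summable_mul (g := fun j => g (τ x j) - g x) (C := D + D)
    (fun j => (abs_sub _ _).trans (add_le_add (hg _) (hg _))) x
  have : ∀ j, a x j * (b * f (τ x j) + c * g (τ x j) - (b * f x + c * g x)) =
      b * (a x j * (f (τ x j) - f x)) + c * (a x j * (g (τ x j) - g x)) := fun j => by ring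
  simp only [rateOp, this]
  rw [(h1.mul_left b).tsum_add (h2.mul_left c), tsum_mul_left, tsum_mul_left]
  ring

lemma rateOp_const (C : ℝ) (x : S) : rateOp a τ k (fun _ => C) x = - (k x * C) := by
  simp [rateOp]

/-- Maximum principle: a bounded supersolution which is nonnegative at time `0` stays
nonnegative. -/
theorem nonneg_of_supersolution (ha : IsBoundedRates a R) (hk : ∀ x, 0 ≤ k x) {w w' : ℝ → S → ℝ}
    {C : ℝ} (hC : ∀ t, 0 ≤ t → ∀ x, |w t x| ≤ C)
    (hc : ∀ x, ContinuousOn (fun t => w t x) (Set.Ici 0))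
    (hd : ∀ t, 0 ≤ t → ∀ x, HasDerivWithinAt (fun t => w t x) (w' t x) (Set.Ici t) t)
    (hw : ∀ t, 0 ≤ t → ∀ x, rateOp a τ k (w t) x ≤ w' t x)
    (h0 : ∀ x, 0 ≤ w 0 x) {t : ℝ} (ht : 0 ≤ t) (x : S) : 0 ≤ w t x := by
  have hCnn : 0 ≤ C := (abs_nonneg _).trans (hC 0 le_rfl x)
  set D : ℝ := C + 1
  have hD : 0 < D := by positivity
  set r : ℝ := |R| + 1
  have hr : R < r := lt_of_le_of_lt (le_abs_self R) (lt_add_one _)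
  have hrpos : 0 < r := by positivity
  -- On an infinite state space the infimum need not be attained, so the bound on the negative part
  -- is halved repeatedly. If all states satisfy w ≥ -b with b = D 2⁻ⁿ e^{2rt}, then where w first
  -- touches -b/2 its downward speed is at most R b < r b, while r b is exactly the speed of the
  -- barrier -b/2. This is why the exponent is 2r.
  have key : ∀ n : ℕ, ∀ t, 0 ≤ t → ∀ x, - w t x ≤ D * (1 / 2) ^ n * Real.exp (2 * r * t) := by
    intro n
    induction n with
    | zero =>
      intro t ht x
      have h1 : - w t x ≤ C := (neg_le_abs _).trans (hC t ht x)
      have h2 : (1 : ℝ) ≤ Real.exp (2 * r * t) := Real.one_le_exp (by positivity)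
      nlinarith
    | succ n ih =>
      intro t ht x
      have hB : ∀ s, HasDerivAt (fun s => D * (1 / 2) ^ (n + 1) * Real.exp (2 * r * s))
          (r * (D * (1 / 2) ^ n * Real.exp (2 * r * s))) s := by
        intro s
        have := (((hasDerivAt_id s).const_mul (2 * r)).exp).const_mul (D * (1 / 2) ^ (n + 1))
        convert! this using 1
        simp only [id, mul_one]
        ring
      refine image_le_of_deriv_right_lt_deriv_boundary (f := fun s => - w s x)
        (f' := fun s => - w' s x) (a := 0) (b := t)
        ((hc x).neg.mono fun s hs => hs.1) (fun s hs => (hd s hs.1 x).neg) ?_ hB ?_ ⟨ht, le_rfl⟩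
      · have := h0 x
        have : 0 ≤ D * (1 / 2) ^ (n + 1) * Real.exp (2 * r * 0) := by positivity
        linarith
      · intro s hs hEq
        set b := D * (1 / 2) ^ n * Real.exp (2 * r * s) with hb
        have hbpos : 0 < b := by positivity
        have hwneg : w s x ≤ 0 := by
          have : 0 ≤ D * (1 / 2) ^ (n + 1) * Real.exp (2 * r * s) := by positivity
          linarith
        have h1 := hw s hs.1 x
        rw [rateOp_eq ha (hC s hs.1)] at h1
        have h2 : -(b * ∑' j, a x j) ≤ ∑' j, a x j * w s (τ x j) := by
          rw [mul_comm, ← tsum_mul_right, ← tsum_neg]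
          refine ((ha.summable x).mul_right b).neg.tsum_le_tsum (fun j => ?_)
            (ha.summable_mul (fun j => hC s hs.1 (τ x j)) x)
          have := ih s hs.1 (τ x j)
          nlinarith [ha.nonneg x j]
        have h3 : 0 ≤ ∑' j, a x j := tsum_nonneg (ha.nonneg x)
        have h4 := ha.tsum_le x
        have h5 := hk x
        nlinarith [mul_nonneg_of_nonpos_of_nonpos hwneg (by linarith : -(∑' j, a x j + k x) ≤ 0)]
  have hlim : Tendsto (fun n : ℕ => D * (1 / 2) ^ n * Real.exp (2 * r * t)) atTop (𝓝 0) := by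
    have := ((tendsto_pow_atTop_nhds_zero_of_lt_one (by norm_num : (0 : ℝ) ≤ 1 / 2)
      (by norm_num)).const_mul D).mul_const (Real.exp (2 * r * t))
    simpa using this
  have := ge_of_tendsto' hlim fun n => key n t ht x
  linarith

variable {u v : ℝ → S → ℝ}

lemma IsFlow.linear (ha : IsBoundedRates a R) (hu : IsFlow a τ k u) (hv : IsFlow a τ k v)
    (b c : ℝ) : IsFlow a τ k fun t x => b * u t x + c * v t x := by
  obtain ⟨C, hC⟩ := hu.bounded
  obtain ⟨D, hD⟩ := hv.bounded
  refine ⟨⟨|b| * C + |c| * D, fun t ht x => ?_⟩, fun x => ?_, fun t ht x => ?_⟩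
  · refine (abs_add_le _ _).trans (add_le_add ?_ ?_) <;> rw [abs_mul]
    · exact mul_le_mul_of_nonneg_left (hC t ht x) (abs_nonneg _)
    · exact mul_le_mul_of_nonneg_left (hD t ht x) (abs_nonneg _)
  · exact ((hu.continuousOn x).const_mul b).add ((hv.continuousOn x).const_mul c)
  · rw [rateOp_linear ha (hC t ht) (hD t ht)]
    exact ((hu.deriv t ht x).const_mul b).add ((hv.deriv t ht x).const_mul c)

lemma IsFlow.shift (hu : IsFlow a τ k u) {s : ℝ} (hs : 0 ≤ s) :
    IsFlow a τ k fun t => u (t + s) := by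
  obtain ⟨C, hC⟩ := hu.bounded
  refine ⟨⟨C, fun t ht x => hC _ (by positivity) x⟩, fun x => ?_, fun t ht x => ?_⟩
  · refine (hu.continuousOn x).comp (by fun_prop) fun t ht => ?_
    have : 0 ≤ t := ht
    exact add_nonneg this hs
  · have h1 := hu.deriv (t + s) (by positivity) x
    have h2 : HasDerivWithinAt (fun t : ℝ => t + s) 1 (Set.Ici t) t :=
      ((hasDerivAt_id t).add_const s).hasDerivWithinAt
    have := h1.scomp t h2 fun y hy => by
      have : t ≤ y := hy
      exact add_le_add_left this s
    simpa [Function.comp_def] using this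

lemma IsFlow.nonneg (ha : IsBoundedRates a R) (hk : ∀ x, 0 ≤ k x) (hu : IsFlow a τ k u)
    (h0 : ∀ x, 0 ≤ u 0 x) {t : ℝ} (ht : 0 ≤ t) (x : S) : 0 ≤ u t x := by
  obtain ⟨C, hC⟩ := hu.bounded
  exact nonneg_of_supersolution ha hk hC hu.continuousOn hu.deriv (fun _ _ _ => le_rfl) h0 ht x

lemma IsFlow.mono (ha : IsBoundedRates a R) (hk : ∀ x, 0 ≤ k x) (hu : IsFlow a τ k u)
    (hv : IsFlow a τ k v) (h0 : ∀ x, u 0 x ≤ v 0 x) {t : ℝ} (ht : 0 ≤ t) (x : S) :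
    u t x ≤ v t x := by
  have := (hv.linear ha hu 1 (-1)).nonneg ha hk (fun x => by linarith [h0 x]) ht x
  linarith

lemma IsFlow.le_const (ha : IsBoundedRates a R) (hk : ∀ x, 0 ≤ k x) (hu : IsFlow a τ k u)
    {c : ℝ} (hc : 0 ≤ c) (h0 : ∀ x, u 0 x ≤ c) {t : ℝ} (ht : 0 ≤ t) (x : S) : u t x ≤ c := by
  obtain ⟨C, hC⟩ := hu.bounded
  -- The operator sends the constant c ≥ 0 to -k c ≤ 0, so c - u is a supersolution.
  have := nonneg_of_supersolution (τ := τ) (w := fun t x => c - u t x)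
    (w' := fun t x => - rateOp a τ k (u t) x) (C := |c| + C) ha hk
    (fun t ht x => (abs_sub _ _).trans (add_le_add le_rfl (hC t ht x)))
    (fun x => continuousOn_const.sub (hu.continuousOn x)) (fun t ht x => (hu.deriv t ht x).const_sub c) ?_
    (fun x => by linarith [h0 x]) ht x
  · linarith
  · intro t ht x
    have h1 := rateOp_linear (τ := τ) (k := k) ha (f := fun _ => c) (C := |c|) (fun _ => le_rfl)
      (hC t ht) 1 (-1) x
    have h2 := mul_nonneg (hk x) hc
    rw [rateOp_const] at h1
    have h3 : (fun y => 1 * c + -1 * u t y) = fun x => c - u t x := by ext; ring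
    rw [h3] at h1
    linarith

lemma isFlow_const {g : S → ℝ} {C : ℝ} (hg : ∀ x, |g x| ≤ C) (h : ∀ x, rateOp a τ k g x = 0) :
    IsFlow a τ k fun _ => g :=
  ⟨⟨C, fun _ _ => hg⟩, fun _ => continuousOn_const, fun t _ x => by
    rw [h]; exact hasDerivWithinAt_const _ _ _⟩

/-! ### Survival probabilities and the long-time behaviour of flows. -/

open Classical in
/-- Iterates of the jump chain with killing, started from the constant `1`. -/
noncomputable def survival (a : S → J → ℝ) (τ : S → J → S) (k : S → ℝ) : ℕ → S → ℝ
  | 0, _ => 1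
  -- A state without jumps and killing survives forever; division by zero would give 0 instead.
  | n + 1, x => if ∑' j, a x j + k x = 0 then 1
      else (∑' j, a x j * survival a τ k n (τ x j)) / (∑' j, a x j + k x)

/-- Probability that the chain is never killed. -/
noncomputable def survivalLim (a : S → J → ℝ) (τ : S → J → S) (k : S → ℝ) (x : S) : ℝ :=
  ⨅ n, survival a τ k n x

lemma total_nonneg (ha : IsBoundedRates a R) (hk : ∀ x, 0 ≤ k x) (x : S) :
    0 ≤ ∑' j, a x j + k x := add_nonneg (tsum_nonneg (ha.nonneg x)) (hk x)

lemma survival_mem (ha : IsBoundedRates a R) (hk : ∀ x, 0 ≤ k x) (n : ℕ) :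
    ∀ x, 0 ≤ survival a τ k n x ∧ survival a τ k n x ≤ 1 := by
  induction n with
  | zero => intro x; simp [survival]
  | succ n ih =>
    intro x
    have hT := total_nonneg ha hk x
    rw [survival]
    split_ifs with h
    · simp
    · have hT' : 0 < ∑' j, a x j + k x := lt_of_le_of_ne hT (Ne.symm h)
      refine ⟨div_nonneg (tsum_nonneg fun j => mul_nonneg (ha.nonneg x j) (ih _).1) hT, ?_⟩
      rw [div_le_one hT']
      refine le_trans (Summable.tsum_le_tsum (fun j => ?_) (ha.summable_mul
        (fun j => abs_le.2 ⟨by linarith [(ih (τ x j)).1], (ih (τ x j)).2⟩) x) (ha.summable x))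
        (le_add_of_nonneg_right (hk x))
      exact mul_le_of_le_one_right (ha.nonneg x j) (ih _).2

lemma abs_survival_le (ha : IsBoundedRates a R) (hk : ∀ x, 0 ≤ k x) (n : ℕ) (x : S) :
    |survival a τ k n x| ≤ 1 :=
  abs_le.2 ⟨by linarith [(survival_mem (τ := τ) ha hk n x).1], (survival_mem ha hk n x).2⟩

lemma survival_succ_le (ha : IsBoundedRates a R) (hk : ∀ x, 0 ≤ k x) (n : ℕ) :
    ∀ x, survival a τ k (n + 1) x ≤ survival a τ k n x := by
  induction n with
  | zero => exact fun x => (survival_mem ha hk 1 x).2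
  | succ n ih =>
    intro x
    rw [survival, survival]
    split_ifs with h
    · simp
    · refine div_le_div_of_nonneg_right (Summable.tsum_le_tsum (fun j => ?_) (ha.summable_mul
        (fun j => abs_survival_le ha hk _ _) x) (ha.summable_mul
        (fun j => abs_survival_le ha hk _ _) x)) (total_nonneg ha hk x)
      exact mul_le_mul_of_nonneg_left (ih _) (ha.nonneg x j)

lemma tendsto_survival (ha : IsBoundedRates a R) (hk : ∀ x, 0 ≤ k x) (x : S) :
    Tendsto (fun n => survival a τ k n x) atTop (𝓝 (survivalLim a τ k x)) :=
  tendsto_atTop_ciInf (antitone_nat_of_succ_le fun n => survival_succ_le ha hk n x)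
    ⟨0, by rintro _ ⟨n, rfl⟩; exact (survival_mem ha hk n x).1⟩

lemma survivalLim_mem (ha : IsBoundedRates a R) (hk : ∀ x, 0 ≤ k x) (x : S) :
    0 ≤ survivalLim a τ k x ∧ survivalLim a τ k x ≤ 1 :=
  ⟨ge_of_tendsto' (tendsto_survival ha hk x) fun n => (survival_mem ha hk n x).1,
    le_of_tendsto' (tendsto_survival ha hk x) fun n => (survival_mem ha hk n x).2⟩

lemma abs_survivalLim_le (ha : IsBoundedRates a R) (hk : ∀ x, 0 ≤ k x) (x : S) :
    |survivalLim a τ k x| ≤ 1 :=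
  abs_le.2 ⟨by linarith [(survivalLim_mem (τ := τ) ha hk x).1], (survivalLim_mem ha hk x).2⟩

lemma total_eq_zero (ha : IsBoundedRates a R) (hk : ∀ x, 0 ≤ k x) {x : S}
    (h : ∑' j, a x j + k x = 0) : (∀ j, a x j = 0) ∧ k x = 0 := by
  have h1 : 0 ≤ ∑' j, a x j := tsum_nonneg (ha.nonneg x)
  have h2 := hk x
  have h3 : ∑' j, a x j = 0 := by linarith
  exact ⟨fun j => congrFun ((hasSum_zero_iff_of_nonneg (ha.nonneg x)).1
    (h3 ▸ (ha.summable x).hasSum)) j, by linarith⟩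

/-- The recursion for the iterates passes to the limit by dominated convergence, so the survival
probability is harmonic for the killed chain. -/
lemma rateOp_survivalLim (ha : IsBoundedRates a R) (hk : ∀ x, 0 ≤ k x) (x : S) :
    rateOp a τ k (survivalLim a τ k) x = 0 := by
  by_cases h : ∑' j, a x j + k x = 0
  · obtain ⟨h1, h2⟩ := total_eq_zero ha hk h
    simp [rateOp, h1, h2]
  · rw [rateOp_eq ha (abs_survivalLim_le ha hk)]
    have h1 : Tendsto (fun n => ∑' j, a x j * survival a τ k n (τ x j)) atTop
        (𝓝 (∑' j, a x j * survivalLim a τ k (τ x j))) := by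
      refine tendsto_tsum_of_dominated_convergence (ha.summable x)
        (fun j => (tendsto_survival ha hk _).const_mul _) (Eventually.of_forall fun n j => ?_)
      rw [Real.norm_eq_abs, abs_mul, abs_of_nonneg (ha.nonneg x j)]
      exact mul_le_of_le_one_right (ha.nonneg x j) (abs_survival_le ha hk _ _)
    have h2 := ((tendsto_survival (τ := τ) ha hk x).comp (tendsto_add_atTop_nat 1)).const_mul
      (∑' j, a x j + k x)
    have h3 : (fun n => (∑' j, a x j + k x) *
        ((fun n => survival a τ k n x) ∘ fun n => n + 1) n) =
        fun n => ∑' j, a x j * survival a τ k n (τ x j) := by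
      ext n
      simp only [Function.comp, survival, if_neg h]
      field_simp
    rw [h3] at h2
    rw [tendsto_nhds_unique h1 h2, sub_self]

/-- A nonnegative continuous function cannot have a right derivative tending to a negative
limit. -/
lemma deriv_limit_nonneg {f f' : ℝ → ℝ} {l : ℝ} (hc : ContinuousOn f (Set.Ici 0))
    (hd : ∀ t, 0 ≤ t → HasDerivWithinAt f (f' t) (Set.Ici t) t) (h0 : ∀ t, 0 ≤ t → 0 ≤ f t)
    (hl : Tendsto f' atTop (𝓝 l)) : 0 ≤ l := by
  by_contra! hneg
  have h1 : ∀ᶠ t in atTop, f' t ≤ l / 2 := (hl.eventually (gt_mem_nhds (by linarith))).mono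
    fun t ht => le_of_lt ht
  obtain ⟨t₀, ht₀⟩ := eventually_atTop.1 (h1.and (eventually_ge_atTop 0))
  have hp : 0 ≤ t₀ := (ht₀ t₀ le_rfl).2
  have h2 : ∀ t, t₀ ≤ t → f t ≤ f t₀ + l / 2 * (t - t₀) := fun t ht =>
    image_le_of_deriv_right_le_deriv_boundary (f := f) (f' := f') (a := t₀) (b := t)
      (B := fun t => f t₀ + l / 2 * (t - t₀)) (B' := fun _ => l / 2)
      (hc.mono fun s hs => hp.trans hs.1)
      (fun s hs => hd s (hp.trans hs.1)) (by simp) (by fun_prop)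
      (fun s _ => by
        simpa using ((((hasDerivAt_id s).sub_const t₀).const_mul (l / 2)).const_add
          (f t₀)).hasDerivWithinAt)
      (fun s hs => (ht₀ s hs.1).1) ⟨ht, le_rfl⟩
  have hlt : 0 < -(l / 2) := by linarith
  -- The time at which the line of slope l / 2 through (t₀, f t₀) reaches -1.
  have h3 := h2 (t₀ + (f t₀ + 1) / (-(l / 2)))
    (le_add_of_nonneg_right (div_nonneg (by linarith [h0 t₀ hp]) hlt.le))
  have h4 := h0 (t₀ + (f t₀ + 1) / (-(l / 2)))
    (add_nonneg hp (div_nonneg (by linarith [h0 t₀ hp]) hlt.le))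
  have h5 : l / 2 * (t₀ + (f t₀ + 1) / (-(l / 2)) - t₀) = -(f t₀ + 1) := by
    have := hneg.ne
    field_simp
    ring
  linarith

/-- A bounded subsolution is at most the weighted average of its values after one step, and this
averaging is the monotone operator whose iterates define `survival`. Hence c times the survival
probability is the largest harmonic function bounded by c. -/
lemma le_survival_of_subsolution (ha : IsBoundedRates a R) (hk : ∀ x, 0 ≤ k x) {g : S → ℝ}
    {c : ℝ} (hc : ∀ x, |g x| ≤ c) (hg : ∀ x, 0 ≤ rateOp a τ k g x) (n : ℕ) :
    ∀ x, g x ≤ c * survival a τ k n x := by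
  induction n with
  | zero => intro x; simpa [survival] using (le_abs_self _).trans (hc x)
  | succ n ih =>
    intro x
    rw [survival]
    split_ifs with h
    · simpa using (le_abs_self _).trans (hc x)
    · have hT := lt_of_le_of_ne (total_nonneg ha hk x) (Ne.symm h)
      have h1 := hg x
      rw [rateOp_eq ha hc] at h1
      rw [mul_div_assoc', le_div_iff₀ hT, ← tsum_mul_left]
      have h2 : ∑' j, a x j * g (τ x j) ≤ ∑' j, c * (a x j * survival a τ k n (τ x j)) := by
        refine Summable.tsum_le_tsum (fun j => ?_) (ha.summable_mul (fun j => hc _) x)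
          ((ha.summable_mul (fun j => abs_survival_le ha hk _ _) x).mul_left c)
        have := mul_le_mul_of_nonneg_left (ih (τ x j)) (ha.nonneg x j)
        linarith
      linarith

/-- The flow decreases in time, since a time shift of it starts below c. Its limit is a subsolution,
because a nonnegative function cannot have a derivative with negative limit; so it lies below c
times the survival probability. The reverse bound is comparison with this stationary solution, which
starts below c. -/
lemma IsFlow.tendsto_of_nonneg (ha : IsBoundedRates a R) (hk : ∀ x, 0 ≤ k x)
    (hu : IsFlow a τ k u) {c : ℝ} (hc : 0 ≤ c) (h0 : ∀ x, u 0 x = c) (x : S) :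
    Tendsto (fun t => u t x) atTop (𝓝 (c * survivalLim a τ k x)) := by
  have hle : ∀ t, 0 ≤ t → ∀ x, u t x ≤ c := fun t ht x =>
    hu.le_const ha hk hc (fun x => (h0 x).le) ht x
  have hge : ∀ t, 0 ≤ t → ∀ x, 0 ≤ u t x := fun t ht x =>
    hu.nonneg ha hk (fun x => (h0 x).symm ▸ hc) ht x
  have hanti : ∀ x, AntitoneOn (fun t => u t x) (Set.Ici 0) := by
    intro x s hs t ht hst
    have := (hu.shift (sub_nonneg.2 hst)).mono ha hk hu (fun x => by
      rw [h0, zero_add]; exact hle _ (sub_nonneg.2 hst) x) hs x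
    simpa using this
  have hlim : ∀ x, ∃ g, Tendsto (fun t => u t x) atTop (𝓝 g) := by
    intro x
    have hm : Antitone fun t => u (max t 0) x := fun s t hst =>
      hanti x (Set.mem_Ici.2 (le_max_right _ _)) (Set.mem_Ici.2 (le_max_right _ _))
        (max_le_max_right _ hst)
    refine ⟨⨅ t, u (max t 0) x, (tendsto_atTop_ciInf hm
      ⟨0, by rintro _ ⟨t, rfl⟩; exact hge _ (le_max_right _ _) x⟩).congr' ?_⟩
    filter_upwards [eventually_ge_atTop 0] with t ht
    rw [max_eq_left ht]
  choose g hg using hlim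
  have hgle : ∀ x, |g x| ≤ c := fun x => abs_le.2
    ⟨by linarith [ge_of_tendsto (hg x) ((eventually_ge_atTop 0).mono fun t ht => hge t ht x)],
    le_of_tendsto (hg x) ((eventually_ge_atTop 0).mono fun t ht => hle t ht x)⟩
  have habs : ∀ t, 0 ≤ t → ∀ x, |u t x| ≤ c := fun t ht x =>
    abs_le.2 ⟨by linarith [hge t ht x], hle t ht x⟩
  have hsub : ∀ x, 0 ≤ rateOp a τ k g x := by
    intro x
    refine deriv_limit_nonneg (hu.continuousOn x) (fun t ht => hu.deriv t ht x)
      (fun t ht => hge t ht x) ?_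
    rw [rateOp_eq ha hgle]
    have h1 : Tendsto (fun t => ∑' j, a x j * u t (τ x j)) atTop
        (𝓝 (∑' j, a x j * g (τ x j))) := by
      refine tendsto_tsum_of_dominated_convergence ((ha.summable x).mul_right c)
        (fun j => (hg _).const_mul _) ((eventually_ge_atTop 0).mono fun t ht j => ?_)
      rw [Real.norm_eq_abs, abs_mul, abs_of_nonneg (ha.nonneg x j)]
      exact mul_le_mul_of_nonneg_left (habs t ht _) (ha.nonneg x j)
    refine (h1.sub ((hg x).const_mul (∑' j, a x j + k x))).congr' ?_
    filter_upwards [eventually_ge_atTop 0] with t ht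
    rw [rateOp_eq ha (habs t ht)]
  have hup : g x ≤ c * survivalLim a τ k x :=
    ge_of_tendsto' ((tendsto_survival ha hk x).const_mul c)
      fun n => le_survival_of_subsolution ha hk hgle hsub n x
  have hconst := isFlow_const (τ := τ) (k := k) (abs_survivalLim_le ha hk)
    (rateOp_survivalLim ha hk)
  have hlow : c * survivalLim a τ k x ≤ g x := by
    refine ge_of_tendsto (hg x) ((eventually_ge_atTop 0).mono fun t ht => ?_)
    have := (hconst.linear ha hconst c 0).mono ha hk hu (fun y => by
      rw [h0]
      have := mul_le_of_le_one_right hc (survivalLim_mem (τ := τ) ha hk y).2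
      linarith) ht x
    linarith
  rw [← le_antisymm hup hlow]
  exact hg x

/-- The solution started from a constant converges to this constant times the probability that
the chain is never killed. -/
theorem IsFlow.tendsto (ha : IsBoundedRates a R) (hk : ∀ x, 0 ≤ k x)
    (hu : IsFlow a τ k u) {c : ℝ} (h0 : ∀ x, u 0 x = c) (x : S) :
    Tendsto (fun t => u t x) atTop (𝓝 (c * survivalLim a τ k x)) := by
  rcases le_total 0 c with hc | hc
  · exact hu.tendsto_of_nonneg ha hk hc h0 x
  · have := (hu.linear ha hu (-1) 0).tendsto_of_nonneg ha hk (c := -c) (by linarith)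
      (fun x => by rw [h0]; ring) x
    simpa using this.neg

end Evolution

/-! ### Duality for the exclusion process with a reservoir -/

section Duality

variable {V : Type*} [DecidableEq V]

/-- Uniform bound on the total rates. -/
noncomputable def rateBound (p : V → V → ℝ≥0) : ℝ := (⨆ x, ∑' y, (p x y : ℝ≥0∞)).toReal

omit [DecidableEq V] in
lemma tsum_rate_le_iSup (p : V → V → ℝ≥0) (x : V) :
    ∑' y, (p x y : ℝ≥0∞) ≤ ⨆ x, ∑' y, (p x y : ℝ≥0∞) := le_iSup (fun x => ∑' y, (p x y : ℝ≥0∞)) x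

lemma IsWalkRates.totalRate_ne_top {p : V → V → ℝ≥0} (hp : IsWalkRates p) (x : V) :
    totalRate p x ≠ ∞ := ((tsum_rate_le_iSup p x).trans_lt hp.bounded).ne

lemma IsWalkRates.isBoundedRates {p : V → V → ℝ≥0} (hp : IsWalkRates p) :
    IsBoundedRates (fun x y => (p x y : ℝ)) (rateBound p) := by
  refine ⟨fun x y => (p x y).2, fun x => NNReal.summable_coe.2
    (ENNReal.tsum_coe_ne_top_iff_summable.1 (hp.totalRate_ne_top x)), fun x => ?_⟩
  have h := ENNReal.toReal_mono hp.bounded.ne (tsum_rate_le_iSup p x)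
  rwa [ENNReal.tsum_toReal_eq (fun _ => ENNReal.coe_ne_top)] at h

lemma IsWalkRates.summable {p : V → V → ℝ≥0} (hp : IsWalkRates p) (x : V) :
    Summable fun y => (p x y : ℝ) := hp.isBoundedRates.summable x

/-- Rate of the exchange along `e` for a set of particles: the particle at `e.1` jumps to the
empty site `e.2`. -/
noncomputable def moveRate (p : V → V → ℝ≥0) (A : Finset V) (e : V × V) : ℝ :=
  if e.1 ∈ A ∧ e.2 ∉ A then (p e.1 e.2 : ℝ) else 0

/-- The set `A` with `e.1` replaced by `e.2`. -/
def moveSet (A : Finset V) (e : V × V) : Finset V :=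
  if e.1 ∈ A ∧ e.2 ∉ A then insert e.2 (A.erase e.1) else A

lemma card_moveSet (A : Finset V) (e : V × V) : (moveSet A e).card = A.card := by
  unfold moveSet
  split_ifs with h
  · rw [Finset.card_insert_of_notMem (fun h' => h.2 (Finset.mem_of_mem_erase h')),
      Finset.card_erase_add_one h.1]
  · rfl

lemma moveRate_nonneg (p : V → V → ℝ≥0) (A : Finset V) (e : V × V) : 0 ≤ moveRate p A e := by
  unfold moveRate
  split_ifs
  · exact (p e.1 e.2).2
  · exact le_rfl

omit [DecidableEq V] in
lemma tsum_prod_of_support {A : Finset V} {g : V × V → ℝ} (hg : Summable g)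
    (h0 : ∀ x ∉ A, ∀ y, g (x, y) = 0) : ∑' e, g e = ∑ x ∈ A, ∑' y, g (x, y) := by
  rw [hg.tsum_prod]
  exact tsum_eq_sum fun x hx => by simp [h0 x hx]

lemma summable_fst_mem {p : V → V → ℝ≥0} (hp : IsWalkRates p) (A : Finset V) :
    Summable fun e : V × V => if e.1 ∈ A then (p e.1 e.2 : ℝ) else 0 := by
  refine (summable_prod_of_nonneg fun e => ?_).2 ⟨fun x => ?_, ?_⟩
  · dsimp only; split_ifs
    · exact (p e.1 e.2).2
    · exact le_rfl
  · by_cases hx : x ∈ A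
    · simpa [hx] using hp.summable x
    · simp [hx, summable_zero]
  · exact summable_of_ne_finset_zero (s := A) fun x hx => by simp [hx]

lemma summable_moveRate {p : V → V → ℝ≥0} (hp : IsWalkRates p) (A : Finset V) :
    Summable (moveRate p A) := by
  refine (summable_fst_mem hp A).of_nonneg_of_le (moveRate_nonneg p A) fun e => ?_
  unfold moveRate
  split_ifs with h1 h2 h2
  · exact le_rfl
  · exact absurd h1.1 h2
  · exact (p e.1 e.2).2
  · exact le_rfl

lemma tsum_moveRate_le {p : V → V → ℝ≥0} (hp : IsWalkRates p) (A : Finset V) :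
    ∑' e, moveRate p A e ≤ A.card * rateBound p := by
  rw [tsum_prod_of_support (A := A) (summable_moveRate hp A) (fun x hx y => by simp [moveRate, hx]),
    ← nsmul_eq_mul]
  refine Finset.sum_le_card_nsmul _ _ _ fun x _ => ?_
  refine le_trans (Summable.tsum_le_tsum (fun y => ?_)
    ((summable_moveRate hp A).comp_injective (Prod.mk_right_injective x)) (hp.summable x))
    (hp.isBoundedRates.tsum_le x)
  simp only [moveRate]
  split_ifs
  · exact le_rfl
  · exact (p x y).2

/-- Sets of `n` particles. -/
abbrev Particles (V : Type*) (n : ℕ) : Type _ := {A : Finset V // A.card = n}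

/-- `moveSet` on sets of `n` particles. -/
def moveParticles {n : ℕ} (A : Particles V n) (e : V × V) : Particles V n :=
  ⟨moveSet A e, (card_moveSet _ _).trans A.2⟩

lemma isBoundedRates_moveRate {p : V → V → ℝ≥0} (hp : IsWalkRates p) (n : ℕ) :
    IsBoundedRates (fun (A : Particles V n) e => moveRate p A e) (n * rateBound p) :=
  ⟨fun A e => moveRate_nonneg p A e, fun A => summable_moveRate hp A,
    fun A => (tsum_moveRate_le hp A.1).trans_eq (by rw [A.2])⟩

/-- Killing rate of a set of particles: `c` if the origin is occupied. -/
noncomputable def killRate (o : V) (c : ℝ≥0) (A : Finset V) : ℝ := if o ∈ A then (c : ℝ) else 0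

lemma killRate_nonneg (o : V) (c : ℝ≥0) (A : Finset V) : 0 ≤ killRate o c A := by
  unfold killRate
  split_ifs
  · exact c.2
  · exact le_rfl

/-- The duality functions `∏ x ∈ A, (η x - θ)`. -/
noncomputable def dual (θ : ℝ) (A : Finset V) (η : Config V) : ℝ := ∏ x ∈ A, (occ η x - θ)

/-- Generator of the exclusion process coupled at `o` to a reservoir of density `θ` with total
intensity `c`. -/
noncomputable def reservoirGen (p : V → V → ℝ≥0) (o : V) (θ : ℝ) (c : ℝ≥0) (f : Config V → ℝ)
    (η : Config V) : ℝ :=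
  exclusionGen p f η + c * θ * (1 - occ η o) * (f (flipAt η o) - f η) +
    c * (1 - θ) * occ η o * (f (flipAt η o) - f η)

omit [DecidableEq V] in
lemma occ_mem (η : Config V) (x : V) : occ η x = 0 ∨ occ η x = 1 := by
  unfold occ; split_ifs <;> simp

lemma dual_erase {θ : ℝ} {A : Finset V} {x : V} (hx : x ∈ A) (η : Config V) :
    dual θ A η = (occ η x - θ) * dual θ (A.erase x) η :=
  (Finset.mul_prod_erase A _ hx).symm

lemma dual_update_of_notMem {θ : ℝ} {A : Finset V} {x : V} (hx : x ∉ A) (η : Config V)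
    (b : Bool) : dual θ A (Function.update η x b) = dual θ A η := by
  refine Finset.prod_congr rfl fun z hz => ?_
  have : z ≠ x := fun h => hx (h ▸ hz)
  simp [occ, this]

lemma dual_update_of_mem {θ : ℝ} {A : Finset V} {x : V} (hx : x ∈ A) (η : Config V) (b : Bool) :
    dual θ A (Function.update η x b) = ((if b = true then 1 else 0) - θ) *
      dual θ (A.erase x) η := by
  rw [dual_erase hx, dual_update_of_notMem (Finset.notMem_erase x A)]
  simp [occ]

omit [DecidableEq V] in
lemma abs_dual_le {θ : ℝ} (h0 : 0 ≤ θ) (h1 : θ ≤ 1) (A : Finset V) (η : Config V) :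
    |dual θ A η| ≤ 1 := by
  rw [dual, Finset.abs_prod]
  refine Finset.prod_le_one (fun _ _ => abs_nonneg _) fun x _ => ?_
  rcases occ_mem η x with h | h <;> rw [h, abs_le] <;> constructor <;> linarith

/-- Exchanging the occupations of x and y has the same effect on D_A as exchanging x and y in A. The
two orientations of the bond must be added: a particle moving from y to x may correspond to a dual
particle moving from x to y, and the rates match because p is symmetric. If A contains both sites or
neither, both sides vanish. -/
lemma exclusion_flux_symm {p : V → V → ℝ≥0} (hp : IsWalkRates p) (θ : ℝ) (A : Finset V)
    (η : Config V) (x y : V) :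
    (p x y : ℝ) * (occ η x * (1 - occ η y)) * (dual θ A (moveParticle η x y) - dual θ A η) +
      (p y x : ℝ) * (occ η y * (1 - occ η x)) * (dual θ A (moveParticle η y x) - dual θ A η) =
    moveRate p A (x, y) * (dual θ (moveSet A (x, y)) η - dual θ A η) +
      moveRate p A (y, x) * (dual θ (moveSet A (y, x)) η - dual θ A η) := by
  rw [hp.symm y x]
  rcases eq_or_ne x y with rfl | hxy
  · rcases occ_mem η x with h | h <;> simp [moveRate, h]
  have hne : ∀ {u v : V}, u ≠ v → ∀ b b' : Bool, u ∈ A → v ∈ A →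
      dual θ A (Function.update (Function.update η u b) v b') =
      ((if b' = true then 1 else 0) - θ) * (((if b = true then 1 else 0) - θ) *
        dual θ ((A.erase v).erase u) η) := fun huv b b' hu hv => by
    rw [dual_update_of_mem hv, dual_update_of_mem (Finset.mem_erase.2 ⟨huv, hu⟩)]
  by_cases hx : x ∈ A <;> by_cases hy : y ∈ A
  · have h1 : dual θ A η = (occ η y - θ) * ((occ η x - θ) * dual θ ((A.erase y).erase x) η) := by
      rw [dual_erase hy, dual_erase (Finset.mem_erase.2 ⟨hxy, hx⟩)]
    have h2 := hne hxy false true hx hy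
    have h3 := hne hxy.symm false true hy hx
    rw [Finset.erase_right_comm] at h3
    cases h4 : η x <;> cases h5 : η y <;>
      simp [moveRate, hx, hy, moveParticle, h4, h5, occ, h1, h2, h3]
    exact Or.inr (by ring)
  · have h1 : dual θ A η = (occ η x - θ) * dual θ (A.erase x) η := dual_erase hx η
    have h6 : y ∉ A.erase x := fun h => hy (Finset.mem_of_mem_erase h)
    have h7 : dual θ (moveSet A (x, y)) η = (occ η y - θ) * dual θ (A.erase x) η := by
      simp only [moveSet, hx, hy, not_false_iff, and_self, if_true]
      rw [dual, Finset.prod_insert h6]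
      rfl
    have h2 : dual θ A (Function.update (Function.update η x false) y true) =
        (0 - θ) * dual θ (A.erase x) η := by
      rw [dual_update_of_notMem hy, dual_update_of_mem hx]; simp
    have h3 : dual θ A (Function.update (Function.update η y false) x true) =
        (1 - θ) * dual θ (A.erase x) η := by
      rw [dual_update_of_mem hx, dual_update_of_notMem h6]; simp
    cases h4 : η x <;> cases h5 : η y <;>
      simp [moveRate, hx, hy, moveParticle, h4, h5, occ, h1, h2, h3, h7]
  · have h1 : dual θ A η = (occ η y - θ) * dual θ (A.erase y) η := dual_erase hy η
    have h6 : x ∉ A.erase y := fun h => hx (Finset.mem_of_mem_erase h)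
    have h7 : dual θ (moveSet A (y, x)) η = (occ η x - θ) * dual θ (A.erase y) η := by
      simp only [moveSet, hx, hy, not_false_iff, and_self, if_true]
      rw [dual, Finset.prod_insert h6]
      rfl
    have h2 : dual θ A (Function.update (Function.update η y false) x true) =
        (0 - θ) * dual θ (A.erase y) η := by
      rw [dual_update_of_notMem hx, dual_update_of_mem hy]; simp
    have h3 : dual θ A (Function.update (Function.update η x false) y true) =
        (1 - θ) * dual θ (A.erase y) η := by
      rw [dual_update_of_mem hy, dual_update_of_notMem h6]; simp
    cases h4 : η x <;> cases h5 : η y <;>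
      simp [moveRate, hx, hy, moveParticle, h4, h5, occ, h1, h2, h3, h7, hp.symm y x]
  · have h2 : ∀ u v : V, u ∉ A → v ∉ A → dual θ A (moveParticle η u v) = dual θ A η := by
      intro u v hu hv
      unfold moveParticle
      split_ifs
      · rw [dual_update_of_notMem hv, dual_update_of_notMem hu]
      · rfl
    simp [moveRate, hx, hy, h2]

/-- Exclusion is self-dual: pair the two orientations of every bond and apply `exclusion_flux_symm`.
Both series converge absolutely, since only bonds meeting the finite set A contribute. -/
lemma exclusionGen_dual {p : V → V → ℝ≥0} (hp : IsWalkRates p) {θ : ℝ} (h0 : 0 ≤ θ) (h1 : θ ≤ 1)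
    (A : Finset V) (η : Config V) :
    exclusionGen p (dual θ A) η =
      ∑' e, moveRate p A e * (dual θ (moveSet A e) η - dual θ A η) := by
  have hdiff : ∀ (B : Finset V) ζ, |dual θ B ζ - dual θ A η| ≤ 2 := fun B ζ =>
    (abs_sub _ _).trans (by linarith [abs_dual_le h0 h1 B ζ, abs_dual_le h0 h1 A η])
  set g : V × V → ℝ := fun e => (p e.1 e.2 : ℝ) * (occ η e.1 * (1 - occ η e.2)) *
    (dual θ A (moveParticle η e.1 e.2) - dual θ A η)
  set g' : V × V → ℝ := fun e => moveRate p A e * (dual θ (moveSet A e) η - dual θ A η)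
  have hg' : Summable g' := by
    refine Summable.of_norm_bounded ((summable_moveRate hp A).mul_right 2) fun e => ?_
    rw [Real.norm_eq_abs, abs_mul, abs_of_nonneg (moveRate_nonneg p A e)]
    exact mul_le_mul_of_nonneg_left (hdiff _ _) (moveRate_nonneg p A e)
  have hs := summable_fst_mem hp A
  have hs' := (Equiv.prodComm V V).summable_iff.2 hs
  have hg : Summable g := by
    refine Summable.of_norm_bounded ((hs.add hs').mul_right 2) fun e => ?_
    have hocc : |occ η e.1 * (1 - occ η e.2)| ≤ 1 := by
      rcases occ_mem η e.1 with h | h <;> rcases occ_mem η e.2 with h' | h' <;> simp [h, h']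
    have hpnn : (0 : ℝ) ≤ p e.1 e.2 := (p e.1 e.2).2
    have hle : |g e| ≤ (p e.1 e.2 : ℝ) * 2 := by
      simp only [g]
      rw [abs_mul, abs_mul, abs_of_nonneg hpnn]
      have := mul_le_mul hocc (hdiff A (moveParticle η e.1 e.2)) (abs_nonneg _) zero_le_one
      nlinarith
    simp only [Real.norm_eq_abs, Function.comp, Equiv.prodComm_apply, Prod.fst_swap, Prod.snd_swap]
    by_cases hx : e.1 ∈ A <;> by_cases hy : e.2 ∈ A <;> simp only [hx, hy, if_true, if_false]
    · nlinarith [(p e.2 e.1).2]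
    · nlinarith
    · rw [hp.symm e.2 e.1]; nlinarith
    · have : dual θ A (moveParticle η e.1 e.2) = dual θ A η := by
        unfold moveParticle
        split_ifs
        · rw [dual_update_of_notMem hy, dual_update_of_notMem hx]
        · rfl
      simp [g, this]
  have hsw : ∀ f : V × V → ℝ, ∑' e, f e = ∑' e : V × V, f e.swap :=
    fun f => ((Equiv.prodComm V V).tsum_eq f).symm
  have hgs : Summable fun e : V × V => g e.swap := (Equiv.prodComm V V).summable_iff.2 hg
  have hgs' : Summable fun e : V × V => g' e.swap := (Equiv.prodComm V V).summable_iff.2 hg'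
  -- Each sum is counted twice, the second time with reversed bonds, so that the bondwise identity
  -- applies.
  have key : ∑' e, g e + ∑' e, g e = ∑' e, g' e + ∑' e, g' e := by
    nth_rewrite 2 [hsw g]
    nth_rewrite 2 [hsw g']
    rw [← hg.tsum_add hgs, ← hg'.tsum_add hgs']
    exact tsum_congr fun e => exclusion_flux_symm hp θ A η e.1 e.2
  have : ∑' e, g e = ∑' e, g' e := by linarith
  exact this

/-- The centring at θ is chosen for this: the flips at the origin act on η_o - θ as cθ(1 - η_o) -
c(1 - θ)η_o = -c(η_o - θ), which is pure killing at rate c. -/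
lemma reservoirGen_dual {p : V → V → ℝ≥0} (hp : IsWalkRates p) {θ : ℝ} (h0 : 0 ≤ θ) (h1 : θ ≤ 1)
    (o : V) (c : ℝ≥0) (A : Finset V) (η : Config V) :
    reservoirGen p o θ c (dual θ A) η =
      ∑' e, moveRate p A e * (dual θ (moveSet A e) η - dual θ A η) -
        killRate o c A * dual θ A η := by
  rw [reservoirGen, exclusionGen_dual hp h0 h1, add_assoc, sub_eq_add_neg]
  congr 1
  by_cases ho : o ∈ A
  · rw [flipAt, dual_update_of_mem ho, dual_erase ho]
    cases h : η o <;> simp [killRate, ho, occ, h] <;> ring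
  · simp [flipAt, dual_update_of_notMem ho, killRate, ho]

end Duality

/-! ### Evolution of expectations under a Feller semigroup -/

section Semigroup

variable {E : Type*} [TopologicalSpace E] [MeasurableSpace E] [CompactSpace E] [BorelSpace E]

lemma integrable_continuous (μ : Measure E) [IsProbabilityMeasure μ] (f : C(E, ℝ)) :
    Integrable f μ :=
  (BoundedContinuousFunction.mkOfCompact f).integrable μ

lemma FellerSemigroup.integral_evolve (T : FellerSemigroup E) (π : ProbabilityMeasure E) (t : ℝ≥0)
    (f : C(E, ℝ)) :
    ∫ y, f y ∂(T.evolve π t : Measure E) = ∫ x, ∫ y, f y ∂(T.kernel t x) ∂(π : Measure E) := by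
  have h : (T.evolve π t : Measure E) =
      (T.kernel t ∘ₖ Kernel.const Unit (π : Measure E)) () := by
    rw [Kernel.comp_apply]; rfl
  rw [h, Kernel.integral_comp]
  · simp
  · rw [← h]
    exact integrable_continuous _ f

omit [CompactSpace E] [BorelSpace E] in
lemma FellerSemigroup.evolve_add (T : FellerSemigroup E) (π : ProbabilityMeasure E) (s t : ℝ≥0) :
    T.evolve π (s + t) = T.evolve (T.evolve π s) t := by
  apply Subtype.ext
  change T.kernel (s + t) ∘ₘ (π : Measure E) = T.kernel t ∘ₘ (T.kernel s ∘ₘ (π : Measure E))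
  rw [T.kernel_add, Measure.comp_assoc]

omit [CompactSpace E] [BorelSpace E] in
lemma FellerSemigroup.evolve_zero (T : FellerSemigroup E) (π : ProbabilityMeasure E) :
    T.evolve π 0 = π := by
  apply Subtype.ext
  change T.kernel 0 ∘ₘ (π : Measure E) = π
  rw [T.kernel_zero]
  exact Measure.bind_dirac

/-- Expectation of `f` at time `t` for the process started from `π`. -/
noncomputable def expectAt (T : FellerSemigroup E) (π : ProbabilityMeasure E) (f : E → ℝ)
    (t : ℝ) : ℝ := ∫ y, f y ∂(T.evolve π t.toNNReal : Measure E)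

lemma integrable_kernel (T : FellerSemigroup E) (π : ProbabilityMeasure E) (f : C(E, ℝ))
    (t : ℝ≥0) : Integrable (fun x => ∫ y, f y ∂(T.kernel t x)) (π : Measure E) :=
  integrable_continuous (π : Measure E) ⟨_, T.feller t f⟩

lemma integral_evolve_sub (T : FellerSemigroup E) (π : ProbabilityMeasure E) (f : C(E, ℝ))
    (t : ℝ≥0) : ∫ y, f y ∂(T.evolve π t : Measure E) - ∫ y, f y ∂(π : Measure E) =
      ∫ x, (∫ y, f y ∂(T.kernel t x) - f x) ∂(π : Measure E) := by
  rw [T.integral_evolve, integral_sub (integrable_kernel T π f t) (integrable_continuous _ f)]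

lemma abs_integral_evolve_sub_le (T : FellerSemigroup E) (π : ProbabilityMeasure E) (f : C(E, ℝ))
    (t : ℝ≥0) {ε : ℝ} (h : ∀ x, |∫ y, f y ∂(T.kernel t x) - f x| ≤ ε) :
    |∫ y, f y ∂(T.evolve π t : Measure E) - ∫ y, f y ∂(π : Measure E)| ≤ ε := by
  rw [integral_evolve_sub]
  simpa using norm_integral_le_of_norm_le_const (μ := (π : Measure E))
    (f := fun x => ∫ y, f y ∂(T.kernel t x) - f x) (Eventually.of_forall h)

lemma continuousOn_expectAt (T : FellerSemigroup E) (π : ProbabilityMeasure E) (f : C(E, ℝ)) :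
    ContinuousOn (expectAt T π f) (Set.Ici 0) := by
  -- Strong continuity at time 0 is uniform in the starting point, so the semigroup property
  -- transports this one modulus of continuity to all times.
  have hmod : ∀ ε > 0, ∃ δ > 0, ∀ h : ℝ≥0, (h : ℝ) < δ →
      ∀ x, |∫ y, f y ∂(T.kernel h x) - f x| ≤ ε := by
    intro ε hε
    have h1 := Metric.tendstoUniformly_iff.1 (T.strongly_continuous f) ε hε
    obtain ⟨δ, hδ, h2⟩ := Metric.mem_nhdsWithin_iff.1 h1
    refine ⟨δ, hδ, fun h hh x => ?_⟩
    rcases eq_or_lt_of_le (show 0 ≤ h from bot_le) with h0 | h0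
    · rw [← h0, T.kernel_zero, Kernel.id_apply, integral_dirac' _ _
        f.continuous.stronglyMeasurable]
      simpa using hε.le
    · have := h2 ⟨by simpa [NNReal.dist_eq] using hh, h0⟩ x
      rw [dist_comm, Real.dist_eq] at this
      exact this.le
  have hle : ∀ ε > 0, ∃ δ > 0, ∀ s t : ℝ, 0 ≤ s → s ≤ t → t - s < δ →
      |expectAt T π f t - expectAt T π f s| ≤ ε := by
    intro ε hε
    obtain ⟨δ, hδ, h⟩ := hmod ε hε
    refine ⟨δ, hδ, fun s t hs hst hlt => ?_⟩
    have h1 : t.toNNReal = s.toNNReal + (t - s).toNNReal := by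
      rw [← Real.toNNReal_add hs (sub_nonneg.2 hst)]
      congr 1; ring
    unfold expectAt
    rw [h1, T.evolve_add]
    refine abs_integral_evolve_sub_le T _ f _ (h _ ?_)
    rwa [Real.coe_toNNReal _ (sub_nonneg.2 hst)]
  refine Metric.continuousOn_iff.2 fun s hs ε hε => ?_
  obtain ⟨δ, hδ, h⟩ := hle (ε / 2) (half_pos hε)
  refine ⟨δ, hδ, fun t ht hd => ?_⟩
  rw [Real.dist_eq] at hd ⊢
  rcases le_total s t with hst | hst
  · exact (h s t hs hst (by rwa [abs_of_nonneg (sub_nonneg.2 hst)] at hd)).trans_lt (half_lt_self hε)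
  · rw [abs_sub_comm] at hd ⊢
    exact (h t s ht hst (by rwa [abs_of_nonneg (sub_nonneg.2 hst)] at hd)).trans_lt (half_lt_self hε)

/-- The slope between t and t + h is the integral of the difference quotient at time h against the
law at time t, and the quotient converges uniformly. Only the right derivative comes out directly;
together with continuity it is enough for the comparison principle. -/
lemma hasDerivWithinAt_expectAt (T : FellerSemigroup E) (π : ProbabilityMeasure E) (f g : C(E, ℝ))
    (hg : TendstoUniformly (fun (t : ℝ≥0) x => ((∫ y, f y ∂(T.kernel t x)) - f x) / (t : ℝ))
      g (𝓝[>] 0)) {t : ℝ} (ht : 0 ≤ t) :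
    HasDerivWithinAt (expectAt T π f) (expectAt T π g t) (Set.Ici t) t := by
  rw [← hasDerivWithinAt_Ioi_iff_Ici, hasDerivWithinAt_iff_tendsto_slope' Set.self_notMem_Ioi]
  set μ := T.evolve π t.toNNReal
  have h1 : Tendsto (fun h : ℝ≥0 =>
      ∫ x, ((∫ y, f y ∂(T.kernel h x)) - f x) / (h : ℝ) ∂(μ : Measure E)) (𝓝[>] 0)
      (𝓝 (∫ x, g x ∂(μ : Measure E))) := by
    refine Metric.tendsto_nhds.2 fun ε hε => ?_
    filter_upwards [Metric.tendstoUniformly_iff.1 hg (ε / 2) (half_pos hε)] with h hh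
    rw [Real.dist_eq, ← integral_sub]
    · refine lt_of_le_of_lt ?_ (half_lt_self hε)
      have := norm_integral_le_of_norm_le_const (μ := (μ : Measure E)) (C := ε / 2)
        (f := fun x => ((∫ y, f y ∂(T.kernel h x)) - f x) / (h : ℝ) - g x)
        (Eventually.of_forall fun x => by
          have := hh x
          rw [dist_comm, Real.dist_eq] at this
          exact this.le)
      simpa using this
    · exact ((integrable_kernel T μ f h).sub (integrable_continuous _ f)).div_const _
    · exact integrable_continuous _ g
  have h2 : Tendsto (fun s : ℝ => (s - t).toNNReal) (𝓝[>] t) (𝓝[>] 0) := by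
    refine tendsto_nhdsWithin_iff.2 ⟨?_, ?_⟩
    · have : Tendsto (fun s : ℝ => (s - t).toNNReal) (𝓝 t) (𝓝 (t - t).toNNReal) :=
        (continuous_real_toNNReal.comp (continuous_id.sub continuous_const)).tendsto t
      rw [sub_self, Real.toNNReal_zero] at this
      exact this.mono_left nhdsWithin_le_nhds
    · filter_upwards [self_mem_nhdsWithin] with s hs
      exact Real.toNNReal_pos.2 (sub_pos.2 hs)
  refine (h1.comp h2).congr' ?_
  filter_upwards [self_mem_nhdsWithin] with s hs
  have hst : 0 ≤ s - t := (sub_pos.2 hs).le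
  have h3 : s.toNNReal = t.toNNReal + (s - t).toNNReal := by
    rw [← Real.toNNReal_add ht hst]
    congr 1; ring
  simp only [Function.comp]
  rw [integral_div, ← integral_evolve_sub, slope_def_field, expectAt, expectAt, h3, T.evolve_add,
    Real.coe_toNNReal _ hst]

end Semigroup

/-! ### Expectations of the duality functions as flows of the dual process. -/

section DualFlow

variable {V : Type*} [DecidableEq V]

omit [DecidableEq V] in
lemma continuous_occ (x : V) : Continuous fun η : Config V => occ η x := by
  have : Continuous fun b : Bool => if b = true then (1 : ℝ) else 0 := continuous_of_discreteTopology
  exact this.comp (continuous_apply x)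

omit [DecidableEq V] in
lemma continuous_dual (θ : ℝ) (A : Finset V) : Continuous (dual θ A) :=
  continuous_finsetProd _ fun x _ => (continuous_occ x).sub continuous_const

omit [DecidableEq V] in
lemma isLocal_dual (θ : ℝ) (A : Finset V) : IsLocal (dual θ A) :=
  ⟨A, fun η ζ h => Finset.prod_congr rfl fun x hx => by rw [occ, occ, h x hx]⟩

/-- `dual θ A` as a continuous map. -/
noncomputable def dualMap (θ : ℝ) (A : Finset V) : C(Config V, ℝ) := ⟨dual θ A, continuous_dual θ A⟩

/-- By duality the generator image is a uniformly convergent series of continuous functions;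
continuity is needed to integrate it and to differentiate the expectation. -/
lemma continuous_reservoirGen_dual {p : V → V → ℝ≥0} (hp : IsWalkRates p) {θ : ℝ} (h0 : 0 ≤ θ)
    (h1 : θ ≤ 1) (o : V) (c : ℝ≥0) (A : Finset V) :
    Continuous (reservoirGen p o θ c (dual θ A)) := by
  have : reservoirGen p o θ c (dual θ A) = fun η =>
      ∑' e, moveRate p A e * (dual θ (moveSet A e) η - dual θ A η) -
        killRate o c A * dual θ A η := funext fun η => reservoirGen_dual hp h0 h1 o c A η
  rw [this]
  refine (continuous_tsum (fun e => continuous_const.mul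
    ((continuous_dual θ _).sub (continuous_dual θ A))) ((summable_moveRate hp A).mul_right 2)
    fun e η => ?_).sub (continuous_const.mul (continuous_dual θ A))
  simp only [Pi.mul_apply, Pi.sub_apply]
  rw [Real.norm_eq_abs, abs_mul, abs_of_nonneg (moveRate_nonneg p A e)]
  exact mul_le_mul_of_nonneg_left ((abs_sub _ _).trans
    (by linarith [abs_dual_le h0 h1 (moveSet A e) η, abs_dual_le h0 h1 A η]))
    (moveRate_nonneg p A e)

variable [Countable V]

omit [Countable V] in
lemma abs_expectAt_dual_le (T : FellerSemigroup (Config V)) (π : ProbabilityMeasure (Config V))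
    {θ : ℝ} (h0 : 0 ≤ θ) (h1 : θ ≤ 1) (A : Finset V) (t : ℝ) :
    |expectAt T π (dual θ A) t| ≤ 1 := by
  have := norm_integral_le_of_norm_le_const
    (μ := (T.evolve π t.toNNReal : Measure (Config V))) (f := dual θ A) (C := 1)
    (Eventually.of_forall fun η => abs_dual_le h0 h1 A η)
  simpa [expectAt] using this

/-- Expectations of the duality functions solve the evolution equation of the exclusion process
killed at the origin. -/
theorem isFlow_expectAt_dual {p : V → V → ℝ≥0} (hp : IsWalkRates p) {θ : ℝ} (h0 : 0 ≤ θ)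
    (h1 : θ ≤ 1) (o : V) (c : ℝ≥0) (T : FellerSemigroup (Config V))
    (hT : HasGenerator T (reservoirGen p o θ c)) (π : ProbabilityMeasure (Config V)) (n : ℕ) :
    IsFlow (fun (A : Particles V n) e => moveRate p A e) moveParticles
      (fun A => killRate o c A) (fun t A => expectAt T π (dual θ A) t) := by
  refine ⟨⟨1, fun t _ A => abs_expectAt_dual_le T π h0 h1 A t⟩,
    fun A => continuousOn_expectAt T π (dualMap θ A.1), fun t ht A => ?_⟩
  have h2 := hasDerivWithinAt_expectAt T π (dualMap θ A.1)
    ⟨_, continuous_reservoirGen_dual hp h0 h1 o c A.1⟩ (hT _ (isLocal_dual θ A.1)) ht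
  convert! h2 using 1
  simp only [expectAt, ContinuousMap.coe_mk, rateOp, reservoirGen_dual hp h0 h1]
  set μ : Measure (Config V) := (T.evolve π t.toNNReal : Measure (Config V))
  have hi : ∀ B : Finset V, Integrable (dual θ B) μ := fun B => integrable_continuous μ (dualMap θ B)
  have hF : ∀ e, Integrable (fun η => moveRate p A e *
      (dual θ (moveSet A e) η - dual θ A η)) μ := fun e => ((hi _).sub (hi _)).const_mul _
  have hS : Summable fun e => ∫ η, ‖moveRate p A e *
      (dual θ (moveSet A e) η - dual θ A η)‖ ∂μ := by
    refine ((summable_moveRate hp A.1).mul_right 2).of_nonneg_of_le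
      (fun e => integral_nonneg fun _ => norm_nonneg _) fun e => ?_
    refine (integral_mono (hF e).norm (integrable_const (moveRate p A e * 2)) fun η => ?_).trans
      (by simp)
    simp only [Real.norm_eq_abs, abs_mul, abs_of_nonneg (moveRate_nonneg p A.1 e)]
    exact mul_le_mul_of_nonneg_left ((abs_sub _ _).trans
      (by linarith [abs_dual_le h0 h1 (moveSet A.1 e) η, abs_dual_le h0 h1 A.1 η]))
      (moveRate_nonneg p A.1 e)
  have hI := hasSum_integral_of_summable_integral_norm hF hS
  -- Intensity 0 removes the killing term, so the series alone is an instance of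
  -- `continuous_reservoirGen_dual`.
  have hC : Continuous fun η => ∑' e, moveRate p A e * (dual θ (moveSet A e) η - dual θ A η) := by
    have := (continuous_reservoirGen_dual hp h0 h1 o 0 A.1)
    simpa [funext (reservoirGen_dual hp h0 h1 o 0 A.1), killRate] using this
  have hCi : Integrable (fun η => ∑' e, moveRate p A e *
      (dual θ (moveSet A e) η - dual θ A η)) μ := integrable_continuous μ ⟨_, hC⟩
  rw [integral_sub hCi ((hi _).const_mul _), ← hI.tsum_eq, integral_const_mul]
  congr 1
  refine tsum_congr fun e => ?_
  rw [integral_const_mul, integral_sub (hi _) (hi _)]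
  rfl

end DualFlow

/-! ### Product measures and weak convergence -/

lemma integral_infinitePi_prod {ι : Type*} {X : ι → Type*} [∀ i, MeasurableSpace (X i)]
    (μ : ∀ i, Measure (X i)) [∀ i, IsProbabilityMeasure (μ i)] (s : Finset ι)
    {f : ∀ i, X i → ℝ} (hf : ∀ i, Measurable (f i)) :
    ∫ ω, ∏ i ∈ s, f i (ω i) ∂(Measure.infinitePi μ) = ∏ i ∈ s, ∫ y, f i y ∂(μ i) := by
  have h1 := integral_restrict_infinitePi (μ := μ) (s := s)
    (f := fun y : (∀ i : s, X i) => ∏ i : s, f i (y i))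
    (Finset.measurable_prod Finset.univ fun (i : s) _ => (hf i).comp
      (measurable_pi_apply (X := fun i : s => X i) i)).stronglyMeasurable.aestronglyMeasurable
  rw [integral_fintype_prod_eq_prod (μ := fun i : s => μ i) (fun i : s => f i)] at h1
  rw [← Finset.prod_coe_sort, ← h1]
  refine integral_congr_ae (Eventually.of_forall fun ω => ?_)
  simp only [Finset.restrict]
  rw [← Finset.prod_coe_sort]

section Weak

variable {V : Type*} [DecidableEq V]

omit [DecidableEq V] in
-- By independence of the sites. The value depends on A only through its cardinality, so the flow of
-- n particles started from a product measure has constant initial datum.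
lemma integral_dual_bernoulliProduct (θ : ℝ) (ρ : unitInterval) (A : Finset V) :
    ∫ η, dual θ A η ∂(bernoulliProduct V ρ : Measure (Config V)) = ((ρ : ℝ) - θ) ^ A.card := by
  have h := integral_infinitePi_prod (fun _ : V => bernoulliMeasure true false ρ) A
    (f := fun _ b => (if b = true then (1 : ℝ) else 0) - θ) (fun _ => measurable_of_countable _)
  rw [integral_bernoulliMeasure, Finset.prod_const] at h
  have h2 : (ρ : ℝ) • ((if true = true then (1 : ℝ) else 0) - θ) +
      (1 - ρ : ℝ) • ((if false = true then (1 : ℝ) else 0) - θ) = ρ - θ := by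
    simp; ring
  rw [h2] at h
  exact h

variable [Countable V]

/-- Expand each factor as (η_x - θ) + θ. The products on the left are indicators of cylinder events,
so the duality functions control all of these. -/
lemma integral_prod_occ (μ : Measure (Config V)) [IsProbabilityMeasure μ] (θ : ℝ) (A : Finset V) :
    ∫ η, ∏ x ∈ A, occ η x ∂μ =
      ∑ B ∈ A.powerset, (∫ η, dual θ B η ∂μ) * ∏ _x ∈ A \ B, θ := by
  have h : ∀ η : Config V, ∏ x ∈ A, occ η x =
      ∑ B ∈ A.powerset, dual θ B η * ∏ _x ∈ A \ B, θ := fun η => by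
    refine Eq.trans ?_ (Finset.prod_add (fun x => occ η x - θ) (fun _ => θ) A)
    exact Finset.prod_congr rfl fun x _ => by ring
  simp_rw [h]
  have hi : ∀ B : Finset V, Integrable (dual θ B) μ := fun B => integrable_continuous μ (dualMap θ B)
  rw [integral_finsetSum _ fun B _ => (hi B).mul_const _]
  exact Finset.sum_congr rfl fun B _ => integral_mul_const _ _

/-- A probability measure on configurations is determined by the integrals of the duality
functions. -/
lemma ext_of_integral_dual {μ ν : ProbabilityMeasure (Config V)} (θ : ℝ)
    (h : ∀ A : Finset V, ∫ η, dual θ A η ∂(μ : Measure (Config V)) =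
      ∫ η, dual θ A η ∂(ν : Measure (Config V))) : μ = ν := by
  -- These events form a π-system, as `cyl A ∩ cyl B = cyl (A ∪ B)`, and the singletons A already
  -- generate the product σ-algebra.
  set cyl : Finset V → Set (Config V) := fun A => {η | ∀ x ∈ A, η x = true}
  have hcyl : ∀ A, MeasurableSet (cyl A) := fun A => by
    have : cyl A = ⋂ x ∈ A, (fun η : Config V => η x) ⁻¹' {true} := by
      ext η; simp [cyl]
    rw [this]
    exact Finset.measurableSet_biInter _ fun x _ => measurable_pi_apply x (measurableSet_singleton _)
  have hint : ∀ (κ : ProbabilityMeasure (Config V)) (A : Finset V),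
      ∫ η, ∏ x ∈ A, occ η x ∂(κ : Measure (Config V)) = (κ : Measure (Config V)).real (cyl A) := by
    intro κ A
    rw [← integral_indicator_one (hcyl A)]
    refine integral_congr_ae (Eventually.of_forall fun η => ?_)
    simp only [Set.indicator, cyl, Set.mem_ofPred_eq, Pi.one_apply]
    split_ifs with hη
    · exact Finset.prod_eq_one fun x hx => by simp [occ, hη x hx]
    · push Not at hη
      obtain ⟨x, hx, hne⟩ := hη
      exact Finset.prod_eq_zero hx (by simp [occ, hne])
  apply Subtype.ext
  have : IsFiniteMeasure μ.1 := inferInstanceAs (IsFiniteMeasure (μ : Measure (Config V)))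
  refine ext_of_generate_finite (Set.range cyl) ?_ ?_ ?_ ?_
  · refine le_antisymm ?_ (MeasurableSpace.generateFrom_le ?_)
    · refine iSup_le fun x => ?_
      rw [← measurable_iff_comap_le]
      refine @measurable_to_bool _ (MeasurableSpace.generateFrom (Set.range cyl)) _ ?_
      refine MeasurableSpace.measurableSet_generateFrom ⟨{x}, ?_⟩
      ext η; simp [cyl]
    · rintro _ ⟨A, rfl⟩
      exact hcyl A
  · rintro _ ⟨A, rfl⟩ _ ⟨B, rfl⟩ -
    refine ⟨A ∪ B, ?_⟩
    ext η
    simp only [cyl, Finset.mem_union, Set.mem_ofPred_eq, Set.mem_inter_iff]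
    exact ⟨fun h => ⟨fun x hx => h x (Or.inl hx), fun x hx => h x (Or.inr hx)⟩,
      fun h x hx => hx.elim (h.1 x) (h.2 x)⟩
  · rintro _ ⟨A, rfl⟩
    have : (μ : Measure (Config V)).real (cyl A) = (ν : Measure (Config V)).real (cyl A) := by
      rw [← hint, ← hint, integral_prod_occ _ θ, integral_prod_occ _ θ]
      exact Finset.sum_congr rfl fun B _ => by rw [h]
    exact (measureReal_eq_measureReal_iff (measure_ne_top (μ : Measure (Config V)) _)
      (measure_ne_top (ν : Measure (Config V)) _)).1 this
  · exact (measure_univ (μ := (μ : Measure (Config V)))).trans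
      (measure_univ (μ := (ν : Measure (Config V)))).symm

lemma tendsto_integral_dual {ι : Type*} {l : Filter ι} {π : ι → ProbabilityMeasure (Config V)}
    {m : ProbabilityMeasure (Config V)} (h : Tendsto π l (𝓝 m)) (θ : ℝ) (A : Finset V) :
    Tendsto (fun i => ∫ η, dual θ A η ∂(π i : Measure (Config V))) l
      (𝓝 (∫ η, dual θ A η ∂(m : Measure (Config V)))) :=
  ((ProbabilityMeasure.continuous_integral_continuousMap (dualMap θ A)).tendsto m).comp h

/-- Convergence of the integrals of the duality functions implies weak convergence. -/
theorem exists_tendsto_of_integral_dual {ι : Type*} {l : Filter ι} [l.NeBot]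
    {π : ι → ProbabilityMeasure (Config V)} (θ : ℝ) {L : Finset V → ℝ}
    (h : ∀ A, Tendsto (fun i => ∫ η, dual θ A η ∂(π i : Measure (Config V))) l (𝓝 (L A))) :
    ∃ m : ProbabilityMeasure (Config V), Tendsto π l (𝓝 m) ∧
      ∀ A, ∫ η, dual θ A η ∂(m : Measure (Config V)) = L A := by
  -- Every cluster point has the prescribed integrals, hence there is at most one; compactness of
  -- the space of laws provides one and makes the whole family converge to it.
  have key : ∀ m, ClusterPt m (map π l) → ∀ A, ∫ η, dual θ A η ∂(m : Measure (Config V)) = L A := by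
    intro m hm A
    have h1 : MapClusterPt (∫ η, dual θ A η ∂(m : Measure (Config V))) l
        (fun i => ∫ η, dual θ A η ∂(π i : Measure (Config V))) :=
      MapClusterPt.continuousAt_comp (f := fun κ : ProbabilityMeasure (Config V) =>
        ∫ η, dual θ A η ∂(κ : Measure (Config V)))
        (ProbabilityMeasure.continuous_integral_continuousMap (dualMap θ A)).continuousAt hm
    have h2 : ClusterPt (∫ η, dual θ A η ∂(m : Measure (Config V))) (𝓝 (L A)) := ClusterPt.mono h1 (h A)
    exact eq_of_nhds_neBot h2
  obtain ⟨m, hm⟩ := exists_clusterPt_of_compactSpace (map π l)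
  refine ⟨m, le_nhds_of_unique_clusterPt fun m' hm' => ext_of_integral_dual θ fun A => ?_, key m hm⟩
  rw [key m hm, key m' hm']

theorem tendsto_of_integral_dual {ι : Type*} {l : Filter ι} [l.NeBot]
    {π : ι → ProbabilityMeasure (Config V)} (θ : ℝ) {m : ProbabilityMeasure (Config V)}
    (h : ∀ A, Tendsto (fun i => ∫ η, dual θ A η ∂(π i : Measure (Config V))) l
      (𝓝 (∫ η, dual θ A η ∂(m : Measure (Config V))))) : Tendsto π l (𝓝 m) := by
  obtain ⟨m', hm', he⟩ := exists_tendsto_of_integral_dual θ h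
  rwa [ext_of_integral_dual θ he] at hm'

end Weak

/-! ### Exponential functionals along a trajectory -/

lemma expNeg_nonneg (a : ℝ≥0∞) : 0 ≤ expNeg a := by
  unfold expNeg
  split_ifs
  · exact le_rfl
  · exact (Real.exp_pos _).le

/-- `e^{-a}` with values in `[0, ∞]`. -/
noncomputable def decay (a : ℝ≥0∞) : ℝ≥0∞ := EReal.exp (-(a : EReal))

lemma ofReal_expNeg (a : ℝ≥0∞) : ENNReal.ofReal (expNeg a) = decay a := by
  unfold expNeg decay
  split_ifs with h
  · simp [h]
  · lift a to ℝ≥0 using h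
    have : ((a : ℝ≥0∞) : EReal) = ((a : ℝ) : EReal) := rfl
    rw [this, ← EReal.coe_neg, EReal.exp_coe, ENNReal.coe_toReal]

lemma expNeg_eq_toReal (a : ℝ≥0∞) : expNeg a = (decay a).toReal := by
  rw [← ofReal_expNeg, ENNReal.toReal_ofReal (expNeg_nonneg a)]

lemma decay_le_one (a : ℝ≥0∞) : decay a ≤ 1 := by
  rw [decay, EReal.exp_le_one_iff, EReal.neg_le_zero]
  exact EReal.coe_ennreal_nonneg a

lemma decay_ne_top (a : ℝ≥0∞) : decay a ≠ ∞ := ((decay_le_one a).trans_lt ENNReal.one_lt_top).ne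

lemma decay_zero : decay 0 = 1 := by simp [decay]

lemma decay_top : decay ∞ = 0 := by simp [decay]

lemma decay_eq_zero {a : ℝ≥0∞} : decay a = 0 ↔ a = ∞ := by
  simp [decay]

lemma decay_add (a b : ℝ≥0∞) : decay (a + b) = decay a * decay b := by
  rw [decay, decay, decay, ← EReal.exp_add, EReal.coe_ennreal_add, EReal.neg_add]
  · rfl
  · exact Or.inl (EReal.coe_ennreal_ne_bot a)
  · exact Or.inr (EReal.coe_ennreal_ne_bot b)

lemma continuous_decay : Continuous decay :=
  ENNReal.continuous_exp.comp (continuous_neg.comp continuous_coe_ennreal_ereal)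

lemma antitone_decay : Antitone decay := fun _ _ h =>
  EReal.exp_monotone (EReal.neg_le_neg_iff.2 (EReal.coe_ennreal_le_coe_ennreal_iff.2 h))

lemma decay_sum {ι : Type*} (s : Finset ι) (f : ι → ℝ≥0∞) :
    decay (∑ i ∈ s, f i) = ∏ i ∈ s, decay (f i) := by
  classical
  induction s using Finset.induction_on with
  | empty => simp [decay_zero]
  | insert i s hi ih => rw [Finset.sum_insert hi, Finset.prod_insert hi, decay_add, ih]

lemma tendsto_prod_decay (f : ℕ → ℝ≥0∞) :
    Tendsto (fun n => ∏ i ∈ Finset.range n, decay (f i)) atTop (𝓝 (decay (∑' i, f i))) := by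
  simp_rw [← decay_sum]
  exact (continuous_decay.tendsto _).comp ENNReal.summable.hasSum.tendsto_sum_nat

lemma decay_ofReal {x : ℝ} (hx : 0 ≤ x) :
    decay (ENNReal.ofReal x) = ENNReal.ofReal (Real.exp (-x)) := by
  rw [← ofReal_expNeg, expNeg, if_neg ENNReal.ofReal_ne_top, ENNReal.toReal_ofReal hx]

instance : IsProbabilityMeasure (expMeasure 1) := isProbabilityMeasure_expMeasure one_pos

lemma expMeasure_eq (r : ℝ) : expMeasure r = volume.withDensity (exponentialPDF r) := rfl

lemma measurable_exponentialPDF (r : ℝ) : Measurable (exponentialPDF r) :=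
  (measurable_exponentialPDFReal r).ennreal_ofReal

/-- The discount times the standard exponential density is 1 / (1 + a) times the exponential density
of rate 1 + a, which has mass 1. -/
lemma lintegral_decay_exp {a : ℝ} (ha : 0 ≤ a) :
    ∫⁻ e, decay (ENNReal.ofReal (a * e)) ∂(expMeasure 1) = ENNReal.ofReal (1 / (1 + a)) := by
  have h1a : 0 < 1 + a := by linarith
  have hm : Measurable fun e : ℝ => decay (ENNReal.ofReal (a * e)) :=
    continuous_decay.measurable.comp (ENNReal.measurable_ofReal.comp (measurable_const_mul a))
  rw [expMeasure_eq, lintegral_withDensity_eq_lintegral_mul _ (measurable_exponentialPDF 1) hm]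
  have h : ∀ e, (exponentialPDF 1 * fun e => decay (ENNReal.ofReal (a * e))) e =
      ENNReal.ofReal (1 / (1 + a)) * exponentialPDF (1 + a) e := by
    intro e
    simp only [Pi.mul_apply]
    rcases lt_or_ge e 0 with he | he
    · simp [exponentialPDF_of_neg he]
    · rw [exponentialPDF_of_nonneg he, exponentialPDF_of_nonneg he,
        decay_ofReal (mul_nonneg ha he), ← ENNReal.ofReal_mul (by positivity),
        ← ENNReal.ofReal_mul (by positivity)]
      congr 1
      rw [one_mul, ← Real.exp_add, ← mul_assoc, one_div_mul_cancel h1a.ne', one_mul, one_mul]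
      congr 1; ring
  simp_rw [h]
  rw [lintegral_const_mul _ (measurable_exponentialPDF _), lintegral_exponentialPDF_eq_one h1a,
    mul_one]

lemma expMeasure_pos : ∀ᵐ e ∂(expMeasure 1), 0 < e := by
  rw [ae_iff, expMeasure_eq, withDensity_apply _ (by measurability)]
  have : {a : ℝ | ¬ 0 < a} = Set.Iic 0 := by ext; simp
  rw [this, setLIntegral_congr Iio_ae_eq_Iic.symm]
  exact lintegral_exponentialPDF_of_nonpos le_rfl

/-- Law of an i.i.d. sequence of standard exponential clocks. -/
noncomputable abbrev clockLaw : Measure (ℕ → ℝ) := Measure.infinitePi fun _ : ℕ => expMeasure 1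

lemma lintegral_clock_prod {f : ℕ → ℝ → ℝ≥0∞} (hf : ∀ n, Measurable (f n)) (N : ℕ) :
    ∫⁻ e, ∏ n ∈ Finset.range N, f n (e n) ∂clockLaw =
      ∏ n ∈ Finset.range N, ∫⁻ y, f n y ∂(expMeasure 1) := by
  have h := lintegral_prod_eq_prod_lintegral_of_indepFun (μ := clockLaw) (Finset.range N)
    (fun n (e : ℕ → ℝ) => f n (e n))
    (iIndepFun_infinitePi (P := fun _ : ℕ => expMeasure 1) (X := f) (fun n => hf n))
    (fun n => (hf n).comp (measurable_pi_apply n))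
  rw [h]
  refine Finset.prod_congr rfl fun n _ => ?_
  exact (measurePreserving_eval_infinitePi (fun _ : ℕ => expMeasure 1) n).lintegral_comp (hf n)

/-- Each clock has E e^{-e} = 1/2, so by independence the expectation of e^{-∑ e_n} is at most 2⁻ᴺ
for every N, hence 0. -/
lemma clock_tsum_eq_top : ∀ᵐ e ∂clockLaw, ∑' n, ENNReal.ofReal (e n) = ∞ := by
  have hm : Measurable fun y : ℝ => decay (ENNReal.ofReal y) :=
    continuous_decay.measurable.comp ENNReal.measurable_ofReal
  have hms : Measurable fun e : ℕ → ℝ => decay (∑' n, ENNReal.ofReal (e n)) :=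
    continuous_decay.measurable.comp (Measurable.tsum fun n =>
      ENNReal.measurable_ofReal.comp (measurable_pi_apply n))
  have h0 : ∫⁻ e, decay (∑' n, ENNReal.ofReal (e n)) ∂clockLaw = 0 := by
    have hle : ∀ N : ℕ, ∫⁻ e, decay (∑' n, ENNReal.ofReal (e n)) ∂clockLaw ≤
        (ENNReal.ofReal (1 / 2)) ^ N := by
      intro N
      refine (lintegral_mono fun e => (antitone_decay (ENNReal.sum_le_tsum (Finset.range N))).trans
        (decay_sum _ _).le).trans ?_
      rw [lintegral_clock_prod (fun _ => hm)]
      have := lintegral_decay_exp zero_le_one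
      simp only [one_mul] at this
      rw [this, Finset.prod_const, Finset.card_range]
      norm_num
    refine le_antisymm (ge_of_tendsto' (ENNReal.tendsto_pow_atTop_nhds_zero_of_lt_one ?_) hle) bot_le
    rw [ENNReal.ofReal_lt_one]; norm_num
  filter_upwards [(lintegral_eq_zero_iff hms).1 h0] with e he
  exact decay_eq_zero.1 he

/-! ### Occupation integrals of a trajectory -/

section Path

variable {S : Type*} {q : S → S → ℝ≥0} {ω : Sample S}

lemma jumpTime_zero : jumpTime q ω 0 = 0 := by simp [jumpTime]

lemma jumpTime_succ (n : ℕ) : jumpTime q ω (n + 1) =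
    jumpTime q ω n + ENNReal.ofReal (ω.2 n) / totalRate q (ω.1 n) := by
  rw [jumpTime, Finset.sum_range_succ]; rfl

lemma jumpTime_mono : Monotone (jumpTime q ω) :=
  monotone_nat_of_le_succ fun n => by rw [jumpTime_succ]; exact le_self_add

/-- Sample points for which the jump times are unbounded and states without jumps are
absorbing. -/
structure IsRegular (q : S → S → ℝ≥0) (ω : Sample S) : Prop where
  unbounded : ∑' n, ENNReal.ofReal (ω.2 n) = ∞
  absorbing : ∀ n, totalRate q (ω.1 n) = 0 → ω.1 (n + 1) = ω.1 n

/-- Non-explosion: with rates at most R the holding times dominate the clocks divided by R, whose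
sum diverges. -/
lemma IsRegular.exists_lt_jumpTime (h : IsRegular q ω) {R : ℝ≥0∞} (hR : R ≠ ∞)
    (hq : ∀ x, totalRate q x ≤ R) {a : ℝ≥0∞} (ha : a ≠ ∞) : ∃ n, a < jumpTime q ω n := by
  have h1 : ∑' n, ENNReal.ofReal (ω.2 n) / totalRate q (ω.1 n) = ∞ := by
    rw [eq_top_iff]
    calc ∞ = (∑' n, ENNReal.ofReal (ω.2 n)) * R⁻¹ := by
          rw [h.unbounded, ENNReal.top_mul (ENNReal.inv_ne_zero.2 hR)]
      _ = ∑' n, ENNReal.ofReal (ω.2 n) * R⁻¹ := ENNReal.tsum_mul_right.symm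
      _ ≤ _ := ENNReal.tsum_le_tsum fun n => by
          rw [div_eq_mul_inv]
          exact mul_le_mul_right (ENNReal.inv_le_inv.2 (hq _)) _
  have h2 : Tendsto (jumpTime q ω) atTop (𝓝 ∞) := by
    rw [← h1]
    exact ENNReal.summable.hasSum.tendsto_sum_nat
  exact (h2.eventually (lt_mem_nhds (lt_top_iff_ne_top.2 ha))).exists

lemma position_eq {n : ℕ} {s : ℝ} (h1 : jumpTime q ω n ≤ ENNReal.ofReal s)
    (h2 : ENNReal.ofReal s < jumpTime q ω (n + 1)) : position q s ω = ω.1 n := by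
  unfold position
  refine congrArg ω.1 (IsGreatest.csSup_eq ⟨h1, fun m hm => ?_⟩)
  by_contra! hlt
  exact absurd ((jumpTime_mono (Nat.succ_le_of_lt hlt)).trans hm) (not_le.2 h2)

lemma IsRegular.exists_index (h : IsRegular q ω) {R : ℝ≥0∞} (hR : R ≠ ∞)
    (hq : ∀ x, totalRate q x ≤ R) (s : ℝ) : ∃ n, jumpTime q ω n ≤ ENNReal.ofReal s ∧
      ENNReal.ofReal s < jumpTime q ω (n + 1) := by
  classical
  have hex := h.exists_lt_jumpTime hR hq (a := ENNReal.ofReal s) ENNReal.ofReal_ne_top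
  have hpos : Nat.find hex ≠ 0 := fun h0 => by
    have := Nat.find_spec hex
    rw [h0, jumpTime_zero] at this
    exact not_lt_bot this
  obtain ⟨n, hn⟩ := Nat.exists_eq_succ_of_ne_zero hpos
  refine ⟨n, not_lt.1 (Nat.find_min hex (by omega)), ?_⟩
  have := Nat.find_spec hex
  rwa [hn] at this

lemma volume_window {a b : ℝ≥0∞} (hab : a ≤ b) :
    volume {s : ℝ | 0 < s ∧ a ≤ ENNReal.ofReal s ∧ ENNReal.ofReal s < b} = b - a := by
  rcases eq_or_ne a ∞ with rfl | ha
  · rw [top_le_iff.1 hab, tsub_self]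
    convert measure_empty (μ := (volume : Measure ℝ))
    ext s
    simp
  lift a to ℝ≥0 using ha
  rcases eq_or_ne b ∞ with rfl | hb
  · rw [ENNReal.top_sub_coe, eq_top_iff]
    refine (Real.volume_Ioi (a := (a : ℝ))).ge.trans (measure_mono fun s hs => ?_)
    have hs' : (a : ℝ) < s := hs
    exact ⟨lt_of_le_of_lt a.2 hs', by
      rw [← ENNReal.ofReal_coe_nnreal]
      exact ENNReal.ofReal_le_ofReal hs'.le, ENNReal.ofReal_lt_top⟩
  lift b to ℝ≥0 using hb
  have hv : ((b : ℝ≥0∞) - a) = ENNReal.ofReal ((b : ℝ) - a) := by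
    rw [ENNReal.ofReal_sub _ (NNReal.coe_nonneg a), ENNReal.ofReal_coe_nnreal, ENNReal.ofReal_coe_nnreal]
  rw [hv]
  refine le_antisymm ?_ ?_
  · rw [← Real.volume_Ico]
    refine measure_mono fun s hs => ?_
    obtain ⟨h0, h1, h2⟩ := hs
    rw [← ENNReal.ofReal_coe_nnreal] at h1 h2
    exact ⟨(ENNReal.ofReal_le_ofReal_iff h0.le).1 h1, (ENNReal.ofReal_lt_ofReal_iff_of_nonneg h0.le).1 h2⟩
  · rw [← Real.volume_Ioo]
    refine measure_mono fun s hs => ?_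
    have h0 : 0 < s := lt_of_le_of_lt a.2 hs.1
    refine ⟨h0, ?_, ?_⟩
    · rw [← ENNReal.ofReal_coe_nnreal]; exact ENNReal.ofReal_le_ofReal hs.1.le
    · rw [← ENNReal.ofReal_coe_nnreal]; exact (ENNReal.ofReal_lt_ofReal_iff_of_nonneg h0.le).2 hs.2

/-- The positive times between the `n`-th and the next jump. -/
def window (q : S → S → ℝ≥0) (ω : Sample S) (n : ℕ) : Set ℝ :=
  {s | 0 < s ∧ jumpTime q ω n ≤ ENNReal.ofReal s ∧ ENNReal.ofReal s < jumpTime q ω (n + 1)}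

lemma measurableSet_window (n : ℕ) : MeasurableSet (window q ω n) :=
  measurableSet_Ioi.inter ((ENNReal.measurable_ofReal measurableSet_Ici).inter
    (ENNReal.measurable_ofReal measurableSet_Iio))

lemma IsRegular.position_eq_tsum (h : IsRegular q ω) {R : ℝ≥0∞} (hR : R ≠ ∞)
    (hq : ∀ x, totalRate q x ≤ R) (g : S → ℝ≥0∞) {s : ℝ} (hs0 : 0 < s) :
    g (position q s ω) = ∑' n, (window q ω n).indicator (fun _ => g (ω.1 n)) s := by
  obtain ⟨n, hn1, hn2⟩ := h.exists_index hR hq s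
  have hsn : s ∈ window q ω n := ⟨hs0, hn1, hn2⟩
  rw [position_eq hn1 hn2, tsum_eq_single n]
  · rw [Set.indicator_of_mem hsn]
  · intro m hm
    refine Set.indicator_of_notMem (fun hsm => hm ?_) _
    have e : ∀ {i j : ℕ}, s ∈ window q ω i → s ∈ window q ω j → ¬ i < j := fun hi hj hij =>
      absurd ((jumpTime_mono (Nat.succ_le_of_lt hij)).trans hj.2.1) (not_le.2 hi.2.2)
    have := e hsm hsn
    have := e hsn hsm
    omega

lemma IsRegular.aemeasurable_position (h : IsRegular q ω) {R : ℝ≥0∞} (hR : R ≠ ∞)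
    (hq : ∀ x, totalRate q x ≤ R) (g : S → ℝ≥0∞) :
    AEMeasurable (fun s => g (position q s ω)) (volume.restrict (Set.Ioi 0)) :=
  ⟨fun s => ∑' n, (window q ω n).indicator (fun _ => g (ω.1 n)) s,
    Measurable.tsum fun n => measurable_const.indicator (measurableSet_window n), by
    filter_upwards [ae_restrict_mem measurableSet_Ioi] with s hs
    exact h.position_eq_tsum hR hq g hs⟩

/-- The integral of `g` along a regular trajectory. -/
lemma IsRegular.lintegral_position (h : IsRegular q ω) {R : ℝ≥0∞} (hR : R ≠ ∞)
    (hq : ∀ x, totalRate q x ≤ R) (g : S → ℝ≥0∞) :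
    ∫⁻ s in Set.Ioi (0 : ℝ), g (position q s ω) =
      ∑' n, g (ω.1 n) * (ENNReal.ofReal (ω.2 n) / totalRate q (ω.1 n)) := by
  have hW : ∀ n, MeasurableSet (window q ω n) := measurableSet_window
  have hW0 : ∀ n, window q ω n ⊆ Set.Ioi 0 := fun n s hs => hs.1
  have h1 : ∫⁻ s in Set.Ioi (0 : ℝ), g (position q s ω) =
      ∫⁻ s in Set.Ioi (0 : ℝ), ∑' n, (window q ω n).indicator (fun _ => g (ω.1 n)) s :=
    setLIntegral_congr_fun measurableSet_Ioi fun s hs => h.position_eq_tsum hR hq g hs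
  rw [h1, lintegral_tsum fun n => (measurable_const.indicator (hW n)).aemeasurable]
  have h2 : ∀ n, ∫⁻ s in Set.Ioi (0 : ℝ), (window q ω n).indicator (fun _ => g (ω.1 n)) s =
      g (ω.1 n) * (jumpTime q ω (n + 1) - jumpTime q ω n) := fun n => by
    rw [lintegral_indicator_const (hW n), Measure.restrict_apply (hW n),
      Set.inter_eq_left.2 (hW0 n), window, volume_window (jumpTime_mono n.le_succ)]
  simp_rw [h2]
  by_cases hfin : ∀ n, jumpTime q ω n ≠ ∞
  · refine tsum_congr fun n => ?_
    rw [jumpTime_succ, ENNReal.add_sub_cancel_left (hfin n)]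
  -- Let m be the first index with an infinite holding time; its state has rate 0 and is absorbing.
  -- The differences of jump times after m are ∞ - ∞ = 0 and no longer equal the holding times. If g
  -- vanishes at the absorbing state, all later terms vanish on both sides; otherwise the term m is
  -- infinite on both sides.
  · push Not at hfin
    classical
    have hpos : Nat.find hfin ≠ 0 := fun h0 => by
      have := Nat.find_spec hfin
      rw [h0, jumpTime_zero] at this
      exact ENNReal.zero_ne_top this
    obtain ⟨m, hm⟩ := Nat.exists_eq_succ_of_ne_zero hpos
    have hm1 : jumpTime q ω (m + 1) = ∞ := by
      have := Nat.find_spec hfin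
      rwa [hm] at this
    have hlt : ∀ n, n ≤ m → jumpTime q ω n ≠ ∞ := fun n hn => Nat.find_min hfin (by omega)
    have hinf : ENNReal.ofReal (ω.2 m) / totalRate q (ω.1 m) = ∞ := by
      rw [jumpTime_succ] at hm1
      exact (ENNReal.add_eq_top.1 hm1).resolve_left (hlt m le_rfl)
    by_cases hg : g (ω.1 m) = 0
    · have hr : totalRate q (ω.1 m) = 0 :=
        ((ENNReal.div_eq_top.1 hinf).resolve_right fun h' => ENNReal.ofReal_ne_top h'.1).2
      have hst : ∀ n, m ≤ n → ω.1 n = ω.1 m := by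
        intro n hn
        induction n, hn using Nat.le_induction with
        | base => rfl
        | succ n hn ih => rw [h.absorbing n (by rw [ih, hr]), ih]
      refine tsum_congr fun n => ?_
      rcases le_total n m with hn | hn
      · rw [jumpTime_succ, ENNReal.add_sub_cancel_left (hlt n hn)]
      · rw [hst n hn, hg, zero_mul, zero_mul]
    · rw [ENNReal.tsum_eq_top_of_eq_top ⟨m, ?_⟩, ENNReal.tsum_eq_top_of_eq_top ⟨m, ?_⟩]
      · rw [hinf, ENNReal.mul_top hg]
      · rw [hm1, ENNReal.top_sub (hlt m le_rfl), ENNReal.mul_top hg]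

end Path

/-! ### The jump chain and the Feynman–Kac functional -/

section Chain

variable {S : Type*} [Countable S] [MeasurableSpace S] [MeasurableSingletonClass S]

instance (q : S → S → ℝ≥0) (x : S) : IsProbabilityMeasure (jumpChainLaw q x) := by
  unfold jumpChainLaw; infer_instance

instance (q : S → S → ℝ≥0) (x : S) : IsProbabilityMeasure (chainLaw q x) := by
  unfold chainLaw; infer_instance

lemma lintegral_jumpKernel (q : S → S → ℝ≥0) (x : S) (g : S → ℝ≥0∞) :
    ∫⁻ y, g y ∂(jumpKernel q x) = ∑' y, jumpStep q x y * g y := by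
  have : jumpKernel q x = (jumpStep q x).toMeasure := rfl
  rw [this, lintegral_countable']
  refine tsum_congr fun y => ?_
  rw [PMF.toMeasure_apply_singleton _ _ (measurableSet_singleton y), mul_comm]

/-- Markov property of the jump chain at time `n`. -/
lemma lintegral_jumpChain_succ (q : S → S → ℝ≥0) (x : S) (n : ℕ)
    {f : ((_ : Finset.Iic n) → S) → ℝ≥0∞} (hf : Measurable f) (g : S → ℝ≥0∞) :
    ∫⁻ ω, f (Preorder.frestrictLe n ω) * g (ω (n + 1)) ∂(jumpChainLaw q x) =
      ∫⁻ ω, f (Preorder.frestrictLe n ω) * ∑' y, jumpStep q (ω n) y * g y ∂(jumpChainLaw q x) := by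
  have hg : Measurable g := measurable_of_countable g
  have h1 := Kernel.partialTraj_compProd_eq_map_traj (X := fun _ : ℕ => S) (κ := historyKernel q)
    (Nat.zero_le n) (x₀ := fun _ => x)
  have hm : Measurable fun z : ((_ : Finset.Iic n) → S) × S => f z.1 * g z.2 :=
    (hf.comp measurable_fst).mul (hg.comp measurable_snd)
  have h2 : ∫⁻ ω, f (Preorder.frestrictLe n ω) * g (ω (n + 1)) ∂(jumpChainLaw q x) =
      ∫⁻ z, f z.1 * g z.2 ∂((jumpChainLaw q x).map
        fun ω => (Preorder.frestrictLe n ω, ω (n + 1))) := by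
    rw [lintegral_map hm ((Preorder.measurable_frestrictLe n).prodMk
      (measurable_pi_apply (n + 1)))]
  rw [h2, jumpChainLaw, ← h1, Measure.lintegral_compProd hm,
    ← Kernel.traj_map_frestrictLe_apply, lintegral_map hm.lintegral_kernel_prod_right' (by fun_prop)]
  refine lintegral_congr fun ω => ?_
  dsimp only
  rw [lintegral_const_mul _ hg]
  congr 1
  exact lintegral_jumpKernel q (ω n) g

lemma lintegral_jumpChain_zero (q : S → S → ℝ≥0) (x : S) (g : S → ℝ≥0∞) :
    ∫⁻ ω, g (ω 0) ∂(jumpChainLaw q x) = g x := by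
  have hg : Measurable g := measurable_of_countable g
  have h1 := Kernel.traj_map_frestrictLe_apply (X := fun _ : ℕ => S) (κ := historyKernel q) 0 0
    (fun _ => x)
  rw [Kernel.partialTraj_self, Kernel.id_apply] at h1
  have hm : Measurable fun z : ((_ : Finset.Iic 0) → S) => g (z ⟨0, by simp⟩) :=
    hg.comp (measurable_pi_apply _)
  have h2 : ∫⁻ ω, g (ω 0) ∂(jumpChainLaw q x) =
      ∫⁻ z, g (z ⟨0, by simp⟩) ∂((jumpChainLaw q x).map (Preorder.frestrictLe 0)) := by
    rw [lintegral_map hm (Preorder.measurable_frestrictLe 0)]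
    rfl
  rw [h2, jumpChainLaw, h1, lintegral_dirac' _ hm]

/-- The weighted transition operator of the jump chain. -/
noncomputable def weightedStep (q : S → S → ℝ≥0) (β : S → ℝ≥0∞) (g : S → ℝ≥0∞) (x : S) : ℝ≥0∞ :=
  β x * ∑' y, jumpStep q x y * g y

/-- Integrating out the last step by the Markov property absorbs one factor into the operator; g is
kept general for this induction. -/
lemma lintegral_jumpChain_prod (q : S → S → ℝ≥0) (β : S → ℝ≥0∞) (x : S) (N : ℕ) :
    ∀ g : S → ℝ≥0∞, ∫⁻ ω, (∏ n ∈ Finset.range N, β (ω n)) * g (ω N) ∂(jumpChainLaw q x) =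
      (weightedStep q β)^[N] g x := by
  induction N with
  | zero => intro g; simpa using lintegral_jumpChain_zero q x g
  | succ N ih =>
    intro g
    have hf : Measurable fun z : ((_ : Finset.Iic N) → S) =>
        ∏ n : Finset.Iic N, β (z n) :=
      Finset.measurable_prod Finset.univ fun n _ =>
        (measurable_of_countable β).comp (measurable_pi_apply n)
    have hp : ∀ ω : ℕ → S, ∏ n : Finset.Iic N, β (Preorder.frestrictLe (π := fun _ : ℕ => S) N ω n) =
        ∏ n ∈ Finset.range (N + 1), β (ω n) := fun ω => by
      rw [Nat.range_succ_eq_Iic]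
      exact Finset.prod_coe_sort (Finset.Iic N) fun n => β (ω n)
    have h := lintegral_jumpChain_succ q x N hf g
    simp only [hp] at h
    rw [h, Function.iterate_succ_apply, ← ih]
    refine lintegral_congr fun ω => ?_
    rw [Finset.prod_range_succ, weightedStep, mul_assoc]

/-- At rate 0 the step is the point mass at the current state. The Markov property, tested with the
indicators of being at y at time n and away from y at time n + 1, gives probability 0; the states y
are countably many. -/
lemma ae_jumpChain_absorbing (q : S → S → ℝ≥0) (x : S) :
    ∀ᵐ ω ∂(jumpChainLaw q x), ∀ n, totalRate q (ω n) = 0 → ω (n + 1) = ω n := by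
  classical
  rw [ae_all_iff]
  intro n
  have h : ∀ y : S, totalRate q y = 0 →
      ∀ᵐ ω ∂(jumpChainLaw q x), ω n = y → ω (n + 1) = y := by
    intro y hy
    have hf : Measurable fun z : ((_ : Finset.Iic n) → S) =>
        if z ⟨n, Finset.mem_Iic.2 le_rfl⟩ = y then (1 : ℝ≥0∞) else 0 :=
      (measurable_of_countable fun u : S => if u = y then (1 : ℝ≥0∞) else 0).comp
        (measurable_pi_apply _)
    have h1 := lintegral_jumpChain_succ q x n hf fun z => if z = y then 0 else 1
    have h2 : ∫⁻ ω, (if Preorder.frestrictLe (π := fun _ : ℕ => S) n ω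
        ⟨n, Finset.mem_Iic.2 le_rfl⟩ = y then (1 : ℝ≥0∞) else 0) *
        ∑' z, jumpStep q (ω n) z * (if z = y then 0 else 1) ∂(jumpChainLaw q x) = 0 := by
      refine (lintegral_congr fun ω => ?_).trans lintegral_zero
      have e : Preorder.frestrictLe (π := fun _ : ℕ => S) n ω ⟨n, Finset.mem_Iic.2 le_rfl⟩ = ω n :=
        rfl
      rw [e]
      split_ifs with h0
      · rw [h0, one_mul, ENNReal.tsum_eq_zero]
        intro z
        rw [jumpStep, dif_neg (by simp [hy]), PMF.pure_apply]
        split_ifs <;> simp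
      · rw [zero_mul]
    rw [h2, lintegral_eq_zero_iff (by
      refine Measurable.mul (hf.comp (by fun_prop)) ?_
      exact (measurable_of_countable fun z : S => if z = y then (0 : ℝ≥0∞) else 1).comp
        (measurable_pi_apply _))] at h1
    filter_upwards [h1] with ω hω hn
    by_contra hne
    simp [hn, hne] at hω
  have h' : ∀ᵐ ω ∂(jumpChainLaw q x), ∀ y : S, totalRate q y = 0 → ω n = y → ω (n + 1) = y := by
    rw [ae_all_iff]
    intro y
    by_cases hy : totalRate q y = 0
    · filter_upwards [h y hy] with ω hω _ using hω
    · exact Eventually.of_forall fun ω h0 => absurd h0 hy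
  filter_upwards [h'] with ω hω h0
  exact hω _ h0 rfl

lemma ae_isRegular (q : S → S → ℝ≥0) (x : S) : ∀ᵐ ω ∂(chainLaw q x), IsRegular q ω := by
  have h1 : ∀ᵐ ω ∂(chainLaw q x), ∑' n, ENNReal.ofReal (ω.2 n) = ∞ :=
    Measure.quasiMeasurePreserving_snd.ae clock_tsum_eq_top
  have h2 : ∀ᵐ ω ∂(chainLaw q x), ∀ n, totalRate q (ω.1 n) = 0 → ω.1 (n + 1) = ω.1 n :=
    Measure.quasiMeasurePreserving_fst.ae (ae_jumpChain_absorbing q x)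
  filter_upwards [h1, h2] with ω h1 h2 using ⟨h1, h2⟩

/-- Expected discount at rate `a` during a holding time of total rate `r`. -/
noncomputable def holdWeight (a r : ℝ≥0∞) : ℝ≥0∞ :=
  ∫⁻ e, decay (a * (ENNReal.ofReal e / r)) ∂(expMeasure 1)

lemma holdWeight_zero (r : ℝ≥0∞) : holdWeight 0 r = 1 := by
  simp [holdWeight, decay_zero]

lemma holdWeight_absorbing {a : ℝ≥0∞} (ha : a ≠ 0) : holdWeight a 0 = 0 := by
  unfold holdWeight
  refine (lintegral_congr_ae ?_).trans lintegral_zero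
  -- Positivity of the clock matters: 0 / 0 = 0 in `ℝ≥0∞` would give holding time 0 and no discount.
  filter_upwards [expMeasure_pos] with e he
  rw [ENNReal.div_zero (ENNReal.ofReal_pos.2 he).ne', ENNReal.mul_top ha, decay_top]

/-- The probability r / (r + a) that a clock of rate r rings before a killing clock of rate a;
rescaling reduces it to `lintegral_decay_exp`. -/
lemma holdWeight_eq (a : ℝ≥0) {r : ℝ≥0∞} (h0 : r ≠ 0) (h1 : r ≠ ∞) :
    holdWeight a r = ENNReal.ofReal (r.toReal / (r.toReal + a)) := by
  have hr : 0 < r.toReal := ENNReal.toReal_pos h0 h1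
  have ha : 0 ≤ (a : ℝ) / r.toReal := div_nonneg a.2 hr.le
  have h := lintegral_decay_exp ha
  have e1 : 1 / (1 + (a : ℝ) / r.toReal) = r.toReal / (r.toReal + a) := by
    field_simp
  rw [e1] at h
  rw [holdWeight, ← h]
  refine lintegral_congr fun e => ?_
  congr 1
  rw [div_mul_eq_mul_div, ENNReal.ofReal_div_of_pos hr, ENNReal.ofReal_toReal h1,
    ENNReal.ofReal_mul (NNReal.coe_nonneg a), ENNReal.ofReal_coe_nnreal, mul_div_assoc]

omit [Countable S] [MeasurableSpace S] [MeasurableSingletonClass S] in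
-- A holding time contributes r / (r + k) and the jump q / r; the product q / (r + k) is the weight
-- in the recursion of `survival`. At a state of rate 0 both sides are 1 without killing, and both
-- are 0 after at least one step with killing.
lemma weightedStep_survival {q : S → S → ℝ≥0} {R : ℝ}
    (hq : IsBoundedRates (fun x y => (q x y : ℝ)) R) (k : S → ℝ≥0) (N : ℕ) (x : S) :
    (weightedStep q fun x => holdWeight (k x) (totalRate q x))^[N] (fun _ => 1) x =
      ENNReal.ofReal (survival (fun x y => (q x y : ℝ)) (fun _ y => y) (fun x => (k x : ℝ)) N x) := by
  have hk : ∀ x, 0 ≤ (k x : ℝ) := fun x => (k x).2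
  have htop : ∀ x, totalRate q x ≠ ∞ := fun x =>
    ENNReal.tsum_coe_ne_top_iff_summable.2 (NNReal.summable_coe.1 (hq.summable x))
  have htr : ∀ x, (totalRate q x).toReal = ∑' y, (q x y : ℝ) := fun x =>
    ENNReal.tsum_toReal_eq fun _ => ENNReal.coe_ne_top
  induction N generalizing x with
  | zero => simp [survival]
  | succ N ih =>
    rw [Function.iterate_succ_apply', weightedStep]
    have hP := fun y => (survival_mem (τ := fun _ y => y) hq hk N y).1
    simp_rw [ih]
    by_cases hr : totalRate q x = 0
    · have hq0 : ∀ y, q x y = 0 := fun y => by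
        have := ENNReal.tsum_eq_zero.1 hr y
        simpa using this
      have hs : ∑' y, jumpStep q x y * ENNReal.ofReal (survival (fun x y => (q x y : ℝ))
          (fun _ y => y) (fun x => (k x : ℝ)) N y) = ENNReal.ofReal
          (survival (fun x y => (q x y : ℝ)) (fun _ y => y) (fun x => (k x : ℝ)) N x) := by
        rw [tsum_eq_single x]
        · rw [jumpStep, dif_neg (by simp [hr])]; simp
        · intro y hy
          rw [jumpStep, dif_neg (by simp [hr])]; simp [hy]
      rw [hs, hr, survival]
      by_cases hkx : k x = 0
      · have h1 : ∀ N, survival (fun x y => (q x y : ℝ)) (fun _ y => y) (fun x => (k x : ℝ)) N x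
            = 1 := by
          intro N
          cases N with
          | zero => rfl
          | succ N => rw [survival, if_pos]; simp [hq0, hkx]
        rw [h1, hkx]
        simp [hq0, holdWeight_zero]
      · rw [holdWeight_absorbing (by simpa using hkx)]
        simp [hq0, hkx]
    · have hr' : 0 < ∑' y, (q x y : ℝ) := by
        rw [← htr]; exact ENNReal.toReal_pos hr (htop x)
      have hT : 0 < ∑' y, (q x y : ℝ) + k x := add_pos_of_pos_of_nonneg hr' (hk x)
      rw [holdWeight_eq _ hr (htop x), htr, survival, if_neg hT.ne']
      have hs : ∑' y, jumpStep q x y * ENNReal.ofReal (survival (fun x y => (q x y : ℝ))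
          (fun _ y => y) (fun x => (k x : ℝ)) N y) = ENNReal.ofReal ((∑' y, (q x y : ℝ))⁻¹ *
          ∑' y, (q x y : ℝ) * survival (fun x y => (q x y : ℝ)) (fun _ y => y)
            (fun x => (k x : ℝ)) N y) := by
        rw [← tsum_mul_left, ENNReal.ofReal_tsum_of_nonneg]
        · refine tsum_congr fun y => ?_
          have hstep : jumpStep q x y = q x y * (totalRate q x)⁻¹ := by
            rw [jumpStep, dif_pos ⟨hr, htop x⟩]; rfl
          rw [hstep, ENNReal.ofReal_mul (inv_nonneg.2 hr'.le),
            ENNReal.ofReal_mul (NNReal.coe_nonneg (q x y)),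
            ENNReal.ofReal_coe_nnreal, ENNReal.ofReal_inv_of_pos hr', ← htr,
            ENNReal.ofReal_toReal (htop x)]
          ring
        · exact fun y => mul_nonneg (inv_nonneg.2 hr'.le) (mul_nonneg (q x y).2 (hP y))
        · exact (hq.summable_mul (fun y => abs_survival_le (τ := fun _ y => y) hq hk N y) x).mul_left _
      rw [hs, ← ENNReal.ofReal_mul (div_nonneg hr'.le hT.le)]
      congr 1
      field_simp

omit [Countable S] [MeasurableSpace S] [MeasurableSingletonClass S] in
lemma totalRate_le_ofReal {q : S → S → ℝ≥0} {R : ℝ}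
    (hq : IsBoundedRates (fun x y => (q x y : ℝ)) R) (x : S) :
    totalRate q x ≤ ENNReal.ofReal R := by
  have htop : totalRate q x ≠ ∞ :=
    ENNReal.tsum_coe_ne_top_iff_summable.2 (NNReal.summable_coe.1 (hq.summable x))
  rw [← ENNReal.ofReal_toReal htop]
  refine ENNReal.ofReal_le_ofReal ?_
  rw [totalRate, ENNReal.tsum_toReal_eq fun _ => ENNReal.coe_ne_top]
  exact hq.tsum_le x

/-- The Feynman–Kac functional of a chain with bounded rates. -/
theorem integral_expNeg_eq_survivalLim {q : S → S → ℝ≥0} {R : ℝ}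
    (hq : IsBoundedRates (fun x y => (q x y : ℝ)) R) (k : S → ℝ≥0) (x : S) :
    ∫ ω, expNeg (∫⁻ s in Set.Ioi (0 : ℝ), (k (position q s ω) : ℝ≥0∞)) ∂(chainLaw q x) =
      survivalLim (fun x y => (q x y : ℝ)) (fun _ y => y) (fun x => (k x : ℝ)) x := by
  have hk : ∀ x, 0 ≤ (k x : ℝ) := fun x => (k x).2
  have hqR := totalRate_le_ofReal hq
  set δ : ℕ → Sample S → ℝ≥0∞ := fun n ω =>
    (k (ω.1 n) : ℝ≥0∞) * (ENNReal.ofReal (ω.2 n) / totalRate q (ω.1 n))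
  have hpos : ∀ n, Measurable fun ω : Sample S => ω.1 n := fun n =>
    (measurable_pi_apply n).comp measurable_fst
  have hδ : ∀ n, Measurable (δ n) := fun n =>
    ((measurable_of_countable fun y : S => (k y : ℝ≥0∞)).comp (hpos n)).mul
      ((ENNReal.measurable_ofReal.comp ((measurable_pi_apply n).comp measurable_snd)).div
        ((measurable_of_countable (totalRate q)).comp (hpos n)))
  have hprod : ∀ N, Measurable fun ω => ∏ n ∈ Finset.range N, decay (δ n ω) := fun N =>
    Finset.measurable_prod _ fun n _ => continuous_decay.measurable.comp (hδ n)
  have h1 : (fun ω => expNeg (∫⁻ s in Set.Ioi (0 : ℝ), (k (position q s ω) : ℝ≥0∞)))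
      =ᵐ[chainLaw q x] fun ω => (decay (∑' n, δ n ω)).toReal := by
    filter_upwards [ae_isRegular q x] with ω hω
    rw [expNeg_eq_toReal, hω.lintegral_position ENNReal.ofReal_ne_top hqR fun y => (k y : ℝ≥0∞)]
  rw [integral_congr_ae h1, integral_toReal (f := fun ω => decay (∑' n, δ n ω))
    (continuous_decay.measurable.comp (Measurable.tsum hδ)).aemeasurable
    (Eventually.of_forall fun ω => lt_top_iff_ne_top.2 (decay_ne_top _))]
  have h2 : Tendsto (fun N => ∫⁻ ω, ∏ n ∈ Finset.range N, decay (δ n ω) ∂(chainLaw q x)) atTop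
      (𝓝 (∫⁻ ω, decay (∑' n, δ n ω) ∂(chainLaw q x))) := by
    refine tendsto_lintegral_of_dominated_convergence (fun _ => 1) hprod
      (fun N => Eventually.of_forall fun ω => ?_) (by simp)
      (Eventually.of_forall fun ω => tendsto_prod_decay fun n => δ n ω)
    exact Finset.prod_le_one' fun n _ => decay_le_one _
  -- Given the jump chain the clocks are independent, so integrating them first replaces every
  -- discount by its holding weight.
  have h3 : ∀ N, ∫⁻ ω, ∏ n ∈ Finset.range N, decay (δ n ω) ∂(chainLaw q x) = ENNReal.ofReal
      (survival (fun x y => (q x y : ℝ)) (fun _ y => y) (fun x => (k x : ℝ)) N x) := by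
    intro N
    rw [← weightedStep_survival hq k N x, ← lintegral_jumpChain_prod, chainLaw,
      lintegral_prod _ (hprod N).aemeasurable]
    refine lintegral_congr fun y => ?_
    rw [mul_one]
    refine (lintegral_clock_prod (f := fun n e =>
      decay (k (y n) * (ENNReal.ofReal e / totalRate q (y n)))) (fun n => ?_) N)
    exact continuous_decay.measurable.comp (measurable_const.mul
      (ENNReal.measurable_ofReal.div_const _))
  simp_rw [h3] at h2
  rw [tendsto_nhds_unique h2 (ENNReal.tendsto_ofReal (tendsto_survival hq hk x)),
    ENNReal.toReal_ofReal (survivalLim_mem hq hk x).1]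

end Chain

/-! ### Feynman–Kac functionals of the walk and of the exclusion pair -/

section Functionals

variable {V : Type*} [DecidableEq V]

lemma expNeg_add (a b : ℝ≥0∞) : expNeg (a + b) = expNeg a * expNeg b := by
  rw [expNeg_eq_toReal, decay_add, ENNReal.toReal_mul, ← expNeg_eq_toReal, ← expNeg_eq_toReal]

/-- Killing rate of a walk at `x`. -/
def siteKill (o : V) (c : ℝ≥0) (x : V) : ℝ≥0 := if x = o then c else 0

lemma mul_kron (o : V) (c : ℝ≥0) (x : V) : (c : ℝ≥0∞) * kron x o = siteKill o c x := by
  unfold kron siteKill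
  split_ifs <;> simp

/-- Killing rate of a pair of particles. -/
def pairKill (o : V) (c : ℝ≥0) (a : V × V) : ℝ≥0 := siteKill o c a.1 + siteKill o c a.2

/-- The rates out of (x, y) are supported on the two lines where one coordinate is kept, and each
line is parametrized by V. -/
lemma hasSum_exclusionPairRate {p : V → V → ℝ≥0} (hp : IsWalkRates p) (x y : V) {g : V × V → ℝ}
    {C : ℝ} (hg : ∀ b, |g b| ≤ C) :
    HasSum (fun b => (exclusionPairRate p (x, y) b : ℝ) * g b)
      (∑' z, (if z ≠ x ∧ z ≠ y then (p x z : ℝ) else 0) * g (z, y) +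
        ∑' z, (if z ≠ y ∧ z ≠ x then (p y z : ℝ) else 0) * g (x, z)) := by
  have hs : ∀ (u v : V) (f : V → ℝ), (∀ z, |f z| ≤ C) →
      Summable fun z => (if z ≠ u ∧ z ≠ v then (p u z : ℝ) else 0) * f z := by
    intro u v f hf
    refine Summable.of_norm_bounded ((hp.summable u).mul_right C) fun z => ?_
    have hC : 0 ≤ C := (abs_nonneg _).trans (hf z)
    have hpz : (0 : ℝ) ≤ p u z := NNReal.coe_nonneg _
    rw [Real.norm_eq_abs, abs_mul]
    refine mul_le_mul ?_ (hf z) (abs_nonneg _) hpz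
    split_ifs
    · rw [abs_of_nonneg hpz]
    · simp
  have h1 : HasSum (fun b : V × V => (if b.2 = y ∧ b.1 ≠ x ∧ b.1 ≠ y then (p x b.1 : ℝ) else 0) *
      g b) (∑' z, (if z ≠ x ∧ z ≠ y then (p x z : ℝ) else 0) * g (z, y)) := by
    refine (Function.Injective.hasSum_iff (g := fun z : V => (z, y))
      (fun _ _ h => (Prod.ext_iff.1 h).1) ?_).1 ?_
    · rintro ⟨u, v⟩ h
      have : v ≠ y := fun hv => h ⟨u, by rw [hv]⟩
      simp [this]
    · simpa [Function.comp_def] using (hs x y (fun z => g (z, y)) fun z => hg _).hasSum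
  have h2 : HasSum (fun b : V × V => (if b.1 = x ∧ b.2 ≠ y ∧ b.2 ≠ x then (p y b.2 : ℝ) else 0) *
      g b) (∑' z, (if z ≠ y ∧ z ≠ x then (p y z : ℝ) else 0) * g (x, z)) := by
    refine (Function.Injective.hasSum_iff (g := fun z : V => (x, z))
      (fun _ _ h => (Prod.ext_iff.1 h).2) ?_).1 ?_
    · rintro ⟨u, v⟩ h
      have : u ≠ x := fun hu => h ⟨v, by rw [hu]⟩
      simp [this]
    · simpa [Function.comp_def] using (hs y x (fun z => g (x, z)) fun z => hg _).hasSum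
  convert! h1.add h2 using 1
  ext b
  rw [← add_mul]
  congr 1
  simp only [exclusionPairRate, NNReal.coe_add]
  congr 1 <;> split_ifs <;> simp

lemma tsum_restrict_le {p : V → V → ℝ≥0} (hp : IsWalkRates p) (u v : V) :
    ∑' z, (if z ≠ u ∧ z ≠ v then (p u z : ℝ) else 0) * 1 ≤ rateBound p := by
  have hle : ∀ z, (if z ≠ u ∧ z ≠ v then (p u z : ℝ) else 0) * 1 ≤ p u z := fun z => by
    split_ifs
    · simp
    · simp
  refine (Summable.tsum_le_tsum hle ((hp.summable u).of_nonneg_of_le (fun z => ?_) hle)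
    (hp.summable u)).trans (hp.isBoundedRates.tsum_le u)
  split_ifs <;> simp

lemma isBoundedRates_exclusionPair {p : V → V → ℝ≥0} (hp : IsWalkRates p) :
    IsBoundedRates (fun a b => (exclusionPairRate p a b : ℝ)) (2 * rateBound p) := by
  have h : ∀ a : V × V, HasSum (fun b => (exclusionPairRate p a b : ℝ)) _ := fun a => by
    simpa only [mul_one] using hasSum_exclusionPairRate hp a.1 a.2 (g := fun _ => 1) (C := 1)
      (by simp)
  refine ⟨fun a b => NNReal.coe_nonneg _, fun a => (h a).summable, fun a => ?_⟩
  rw [(h a).tsum_eq, two_mul]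
  exact add_le_add (by simpa using tsum_restrict_le hp a.1 a.2)
    (by simpa using tsum_restrict_le hp a.2 a.1)

lemma tsum_moveRate {p : V → V → ℝ≥0} (hp : IsWalkRates p) (A : Finset V) {F : Finset V → ℝ}
    {C : ℝ} (hF : ∀ B, |F B| ≤ C) :
    ∑' e, moveRate p A e * F (moveSet A e) =
      ∑ x ∈ A, ∑' y, (if y ∉ A then (p x y : ℝ) else 0) * F (insert y (A.erase x)) := by
  have hs : Summable fun e => moveRate p A e * F (moveSet A e) := by
    refine Summable.of_norm_bounded ((summable_moveRate hp A).mul_right C) fun e => ?_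
    rw [Real.norm_eq_abs, abs_mul, abs_of_nonneg (moveRate_nonneg p A e)]
    exact mul_le_mul_of_nonneg_left (hF _) (moveRate_nonneg p A e)
  rw [tsum_prod_of_support (A := A) hs fun x hx y => by simp [moveRate, hx]]
  refine Finset.sum_congr rfl fun x hx => tsum_congr fun y => ?_
  by_cases hy : y ∈ A <;> simp [moveRate, moveSet, hx, hy]

/-- For functions of the unordered pair, jumps of the two-point set and jumps of the labeled pair
have the same rates. -/
lemma tsum_moveRate_pair {p : V → V → ℝ≥0} (hp : IsWalkRates p) {x y : V} (hxy : x ≠ y)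
    {F : Finset V → ℝ} {C : ℝ} (hF : ∀ B, |F B| ≤ C) :
    ∑' e, moveRate p {x, y} e * F (moveSet {x, y} e) =
      ∑' b, (exclusionPairRate p (x, y) b : ℝ) * F {b.1, b.2} := by
  rw [tsum_moveRate hp _ hF, Finset.sum_pair hxy,
    (hasSum_exclusionPairRate hp x y (g := fun b => F {b.1, b.2}) fun b => hF _).tsum_eq]
  have e1 : ({x, y} : Finset V).erase x = {y} := by
    ext z; simp only [Finset.mem_erase, Finset.mem_insert, Finset.mem_singleton]
    constructor
    · rintro ⟨h1, h2⟩; exact h2.resolve_left h1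
    · rintro rfl; exact ⟨hxy.symm, Or.inr rfl⟩
  have e2 : ({x, y} : Finset V).erase y = {x} := by
    rw [Finset.pair_comm]
    ext z; simp only [Finset.mem_erase, Finset.mem_insert, Finset.mem_singleton]
    constructor
    · rintro ⟨h1, h2⟩; exact h2.resolve_left h1
    · rintro rfl; exact ⟨hxy, Or.inr rfl⟩
  rw [e1, e2]
  congr 1
  · refine tsum_congr fun z => ?_
    simp only [Finset.mem_insert, Finset.mem_singleton, not_or, ne_eq]
  · refine tsum_congr fun z => ?_
    rw [Finset.pair_comm x z]
    simp only [Finset.mem_insert, Finset.mem_singleton, not_or, ne_eq, and_comm]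

lemma killRate_pair (o : V) (c : ℝ≥0) {x y : V} (hxy : x ≠ y) :
    killRate o c {x, y} = (pairKill o c (x, y) : ℝ) := by
  simp only [killRate, pairKill, siteKill, Finset.mem_insert, Finset.mem_singleton,
    eq_comm (a := o)]
  by_cases h1 : x = o <;> by_cases h2 : y = o
  · exact absurd (h1.trans h2.symm) hxy
  all_goals simp [h1, h2]

/-- Forgetting labels maps the labeled pair onto the two-point set and preserves jump and killing
rates off the diagonal, which is never entered. The recursions therefore agree by induction. -/
lemma survival_pair {p : V → V → ℝ≥0} (hp : IsWalkRates p) (o : V) (c : ℝ≥0) (N : ℕ) :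
    ∀ {x y : V} (hxy : x ≠ y),
      survival (fun (A : Particles V 2) e => moveRate p A e) moveParticles (fun A => killRate o c A)
        N ⟨{x, y}, Finset.card_pair hxy⟩ =
      survival (fun a b => (exclusionPairRate p a b : ℝ)) (fun _ b => b)
        (fun a => (pairKill o c a : ℝ)) N (x, y) := by
  induction N with
  | zero => intros; rfl
  | succ N ih =>
    intro x y hxy
    -- Extension by 0 to sets of other cardinalities, because `tsum_moveRate_pair` takes functions
    -- on all finite sets.
    set F : Finset V → ℝ := fun B => if h : B.card = 2 then
      survival (fun (A : Particles V 2) e => moveRate p A e) moveParticles (fun A => killRate o c A)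
        N ⟨B, h⟩ else 0 with hFdef
    have hF : ∀ B, |F B| ≤ 1 := fun B => by
      simp only [hFdef]
      split_ifs
      · exact abs_survival_le (isBoundedRates_moveRate hp 2) (fun A => killRate_nonneg o c A.1) N _
      · simp
    have h1 := tsum_moveRate_pair hp hxy hF
    have h2 := tsum_moveRate_pair hp hxy (F := fun _ => 1) (C := 1) (by simp)
    simp only [mul_one] at h2
    have h3 : ∀ e, F (moveSet {x, y} e) = survival (fun (A : Particles V 2) e => moveRate p A e)
        moveParticles (fun A => killRate o c A) N
          (moveParticles ⟨{x, y}, Finset.card_pair hxy⟩ e) := fun e => by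
      simp only [hFdef]
      rw [dif_pos ((card_moveSet _ _).trans (Finset.card_pair hxy))]
      rfl
    have h4 : ∀ b, (exclusionPairRate p (x, y) b : ℝ) * F {b.1, b.2} =
        (exclusionPairRate p (x, y) b : ℝ) * survival (fun a b => (exclusionPairRate p a b : ℝ))
          (fun _ b => b) (fun a => (pairKill o c a : ℝ)) N b := by
      rintro ⟨u, v⟩
      by_cases huv : u = v
      · have : exclusionPairRate p (x, y) (u, v) = 0 := by
          subst huv
          simp only [exclusionPairRate]
          rw [if_neg, if_neg, add_zero]
          · rintro ⟨rfl, h, h'⟩; exact h' rfl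
          · rintro ⟨rfl, h, h'⟩; exact h' rfl
        rw [this]; simp
      · simp only [hFdef]
        rw [dif_pos (Finset.card_pair huv), ih huv]
    simp_rw [h3, h4] at h1
    rw [survival, survival]
    simp only [killRate_pair o c hxy, h2, h1]

lemma survivalLim_pair {p : V → V → ℝ≥0} (hp : IsWalkRates p) (o : V) (c : ℝ≥0) {x y : V}
    (hxy : x ≠ y) :
    survivalLim (fun (A : Particles V 2) e => moveRate p A e) moveParticles
        (fun A => killRate o c A) ⟨{x, y}, Finset.card_pair hxy⟩ =
      survivalLim (fun a b => (exclusionPairRate p a b : ℝ)) (fun _ b => b)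
        (fun a => (pairKill o c a : ℝ)) (x, y) := by
  simp only [survivalLim, survival_pair hp o c _ hxy]

variable [Countable V] [MeasurableSpace V] [MeasurableSingletonClass V]

lemma walkFK_eq {p : V → V → ℝ≥0} (hp : IsWalkRates p) (o : V) (c : ℝ≥0) (x : V) :
    walkFK p o c x = survivalLim (fun x y => (p x y : ℝ)) (fun _ y => y)
      (fun x => (siteKill o c x : ℝ)) x := by
  rw [← integral_expNeg_eq_survivalLim hp.isBoundedRates, walkFK]
  simp_rw [← lintegral_const_mul' _ _ (ENNReal.coe_ne_top (r := c)), mul_kron]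

lemma exclusionFK_eq {p : V → V → ℝ≥0} (hp : IsWalkRates p) (o : V) (c : ℝ≥0) (x y : V) :
    exclusionFK p o c x y = survivalLim (fun a b => (exclusionPairRate p a b : ℝ)) (fun _ b => b)
      (fun a => (pairKill o c a : ℝ)) (x, y) := by
  rw [← integral_expNeg_eq_survivalLim (isBoundedRates_exclusionPair hp), exclusionFK]
  simp_rw [← lintegral_const_mul' _ _ (ENNReal.coe_ne_top (r := c)), mul_add, mul_kron, pairKill,
    ENNReal.coe_add]

/-- The exponential of a sum of occupation times factorizes, then Fubini applies. Splitting the time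
integral requires measurability in time of one summand, which regular trajectories provide. -/
lemma independentFK_eq {p : V → V → ℝ≥0} (hp : IsWalkRates p) (o : V) (c : ℝ≥0) (x y : V) :
    independentFK p o c x y = walkFK p o c x * walkFK p o c y := by
  rw [independentFK, walkFK, walkFK, ← integral_prod_mul]
  refine integral_congr_ae ?_
  filter_upwards [Measure.quasiMeasurePreserving_fst.ae (ae_isRegular p x)] with ω hω
  rw [lintegral_add_left' (hω.aemeasurable_position ENNReal.ofReal_ne_top
    (totalRate_le_ofReal hp.isBoundedRates) fun z => kron z o), mul_add, expNeg_add]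

/-! ### Recurrence -/

omit [Countable V] [MeasurableSpace V] [MeasurableSingletonClass V] in
-- By irreducibility, a vertex without jumps can only reach itself, so it is the only vertex.
lemma eq_of_totalRate_eq_zero {p : V → V → ℝ≥0} (hp : IsWalkRates p) {x : V}
    (h : totalRate p x = 0) (y : V) : y = x := by
  obtain ⟨n, hn⟩ := hp.irreducible x y
  cases n with
  | zero =>
    by_contra hne
    simp [nStepRate, Ne.symm hne] at hn
  | succ n =>
    have : nStepRate p (n + 1) x y = 0 := by
      rw [nStepRate, ENNReal.tsum_eq_zero]
      intro z
      rw [ENNReal.tsum_eq_zero.1 h z, zero_mul]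
    exact absurd hn (by simp [this])

omit [DecidableEq V] [Countable V] [MeasurableSpace V] [MeasurableSingletonClass V] in
-- If no visit had index N or larger, all visits would end by the time of the N-th jump, which is
-- finite because no state has rate 0. This turns recurrence in time into recurrence of the jump
-- chain.
lemma IsRegular.frequently_visit {q : V → V → ℝ≥0} {ω : Sample V} (h : IsRegular q ω) {R : ℝ≥0∞}
    (hR : R ≠ ∞) (hq : ∀ x, totalRate q x ≤ R) (h0 : ∀ x, totalRate q x ≠ 0) {x : V}
    (hx : ¬ BddAbove {t : ℝ | 0 ≤ t ∧ position q t ω = x}) : ∃ᶠ n in atTop, ω.1 n = x := by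
  by_contra hcon
  rw [not_frequently, eventually_atTop] at hcon
  obtain ⟨N, hN⟩ := hcon
  refine hx ⟨(jumpTime q ω N).toReal, ?_⟩
  rintro t ⟨ht, hpos⟩
  obtain ⟨n, hn1, hn2⟩ := h.exists_index hR hq t
  have hnN : n < N := by
    by_contra! hle
    exact hN n hle (by rw [← position_eq hn1 hn2, hpos])
  have hfin : jumpTime q ω N ≠ ∞ := (ENNReal.sum_lt_top.2 fun k _ =>
    ENNReal.div_lt_top ENNReal.ofReal_ne_top (h0 _)).ne
  rw [← ENNReal.toReal_ofReal ht]
  exact ENNReal.toReal_mono hfin (hn2.le.trans (jumpTime_mono (Nat.succ_le_of_lt hnN)))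

/-- The partial products decrease to some L ≤ 1, and passing to the limit along the indices with
factor r gives L ≤ L r, so L = 0. -/
lemma tendsto_prod_zero_of_frequently {b : ℕ → ℝ≥0∞} (hb : ∀ n, b n ≤ 1) {r : ℝ≥0∞} (hr : r < 1)
    (hf : ∃ᶠ n in atTop, b n = r) :
    Tendsto (fun N => ∏ n ∈ Finset.range N, b n) atTop (𝓝 0) := by
  have hanti : Antitone fun N => ∏ n ∈ Finset.range N, b n := antitone_nat_of_succ_le fun N => by
    rw [Finset.prod_range_succ]
    exact mul_le_of_le_one_right' (hb N)
  have hlim := tendsto_atTop_iInf hanti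
  set L := ⨅ N, ∏ n ∈ Finset.range N, b n
  have hL1 : L ≤ 1 := (iInf_le _ 0).trans (by simp)
  have hcl : IsClosed {z : ℝ≥0∞ × ℝ≥0∞ | z.1 ≤ z.2 * r} :=
    isClosed_le continuous_fst ((ENNReal.continuous_mul_const (hr.trans ENNReal.one_lt_top).ne).comp
      continuous_snd)
  have hLr : L ≤ L * r := hcl.mem_of_frequently_of_tendsto (hf.mono fun n hn => by
    change ∏ n ∈ Finset.range (n + 1), b n ≤ (∏ n ∈ Finset.range n, b n) * r
    rw [Finset.prod_range_succ, hn]) ((hlim.comp (tendsto_add_atTop_nat 1)).prodMk_nhds hlim)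
  have hL0 : L = 0 := by
    by_contra hne
    have hLt : L ≠ ∞ := (hL1.trans_lt ENNReal.one_lt_top).ne
    have := ENNReal.mul_lt_mul_right hne hLt hr
    rw [mul_one] at this
    exact absurd hLr (not_le.2 this)
  rwa [hL0] at hlim

/-- Every visit to the origin multiplies the survival weight by the same factor below 1, and a
recurrent walk started there returns infinitely often. -/
lemma survivalLim_origin_eq_zero {p : V → V → ℝ≥0} (hp : IsWalkRates p) {o : V} {c : ℝ≥0}
    (hc : 0 < c) (hrec : IsRecurrent p) :
    survivalLim (fun x y => (p x y : ℝ)) (fun _ y => y) (fun x => (siteKill o c x : ℝ)) o = 0 := by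
  have hB := hp.isBoundedRates
  have hk : ∀ x, 0 ≤ (siteKill o c x : ℝ) := fun x => NNReal.coe_nonneg _
  have hlim := tendsto_survival (τ := fun _ y => y) hB hk o
  have hsk : siteKill o c o = c := by simp [siteKill]
  -- In this case the origin is the only vertex and the first step already kills; visits of the jump
  -- chain can be counted only when all holding times are finite.
  by_cases hr : totalRate p o = 0
  · have hp0 : ∀ y, p o y = 0 := fun y => by
      have := ENNReal.tsum_eq_zero.1 hr y
      simpa using this
    have h1 : survival (fun x y => (p x y : ℝ)) (fun _ y => y)
        (fun x => (siteKill o c x : ℝ)) 1 o = 0 := by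
      rw [survival]
      simp [hp0, hsk, hc.ne']
    refine le_antisymm ?_ (survivalLim_mem hB hk o).1
    rw [← h1]
    exact ciInf_le ⟨0, by rintro _ ⟨n, rfl⟩; exact (survival_mem hB hk n o).1⟩ 1
  · have h0 : ∀ x, totalRate p x ≠ 0 := fun x hx => hr (by
      rw [eq_of_totalRate_eq_zero hp hx o]; exact hx)
    set β : V → ℝ≥0∞ := fun x => holdWeight (siteKill o c x) (totalRate p x) with hβ
    have hβ1 : ∀ x, β x ≤ 1 := fun x => by
      refine (lintegral_mono fun e => decay_le_one _).trans ?_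
      simp
    have hβo : β o < 1 := by
      have hrt : 0 < (totalRate p o).toReal := ENNReal.toReal_pos hr (hp.totalRate_ne_top o)
      have hc' : (0 : ℝ) < c := hc
      simp only [hβ, hsk]
      rw [holdWeight_eq c hr (hp.totalRate_ne_top o), ENNReal.ofReal_lt_one,
        div_lt_one (by positivity)]
      linarith
    have hm : ∀ N, Measurable fun ω : Sample V => ∏ n ∈ Finset.range N, β (ω.1 n) := fun N =>
      Finset.measurable_prod _ fun n _ => (measurable_of_countable β).comp
        ((measurable_pi_apply n).comp measurable_fst)
    have h2 : Tendsto (fun N => ∫⁻ ω, ∏ n ∈ Finset.range N, β (ω.1 n) ∂(chainLaw p o)) atTop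
        (𝓝 (∫⁻ _, 0 ∂(chainLaw p o))) := by
      refine tendsto_lintegral_of_dominated_convergence (fun _ => 1) hm
        (fun N => Eventually.of_forall fun ω => Finset.prod_le_one' fun n _ => hβ1 _) (by simp) ?_
      filter_upwards [ae_isRegular p o, hrec o] with ω hω hv
      exact tendsto_prod_zero_of_frequently (fun n => hβ1 _) hβo
        ((hω.frequently_visit ENNReal.ofReal_ne_top (totalRate_le_ofReal hB) h0 hv).mono
          fun n hn => by rw [hn])
    have h3 : ∀ N, ∫⁻ ω, ∏ n ∈ Finset.range N, β (ω.1 n) ∂(chainLaw p o) = ENNReal.ofReal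
        (survival (fun x y => (p x y : ℝ)) (fun _ y => y) (fun x => (siteKill o c x : ℝ)) N o) := by
      intro N
      rw [← weightedStep_survival hB (siteKill o c) N o, ← lintegral_jumpChain_prod, chainLaw,
        lintegral_prod _ (hm N).aemeasurable]
      refine lintegral_congr fun y => ?_
      simp [hβ]
    simp_rw [h3] at h2
    rw [lintegral_zero] at h2
    have h4 := tendsto_nhds_unique h2 (ENNReal.tendsto_ofReal hlim)
    exact le_antisymm (ENNReal.ofReal_eq_zero.1 h4.symm) (survivalLim_mem hB hk o).1

/-- The survival probability h is nonnegative and harmonic, so at a zero x the equation reads ∑_y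
p(x,y) h(y) = 0 and all neighbours of x are zeros too. Irreducibility spreads the zero from the
origin, without an argument about hitting it. -/
lemma survivalLim_eq_zero {p : V → V → ℝ≥0} (hp : IsWalkRates p) {o : V} {c : ℝ≥0}
    (hc : 0 < c) (hrec : IsRecurrent p) (x : V) :
    survivalLim (fun x y => (p x y : ℝ)) (fun _ y => y) (fun x => (siteKill o c x : ℝ)) x = 0 := by
  have hB := hp.isBoundedRates
  have hk : ∀ x, 0 ≤ (siteKill o c x : ℝ) := fun x => NNReal.coe_nonneg _
  set h := survivalLim (fun x y => (p x y : ℝ)) (fun _ y => y) (fun x => (siteKill o c x : ℝ))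
  have hnn : ∀ x, 0 ≤ h x := fun x => (survivalLim_mem hB hk x).1
  have hstep : ∀ x, h x = 0 → ∀ y, p x y ≠ 0 → h y = 0 := by
    intro x hx y hy
    have h1 := rateOp_survivalLim (τ := fun _ y => y) hB hk x
    change rateOp _ _ _ h x = 0 at h1
    rw [rateOp, hx, mul_zero, sub_zero] at h1
    simp only [sub_zero] at h1
    have hs := hB.summable_mul (g := h) (fun y => abs_survivalLim_le (τ := fun _ y => y) hB hk y) x
    have h2 := (hasSum_zero_iff_of_nonneg fun y => mul_nonneg (NNReal.coe_nonneg (p x y)) (hnn y)).1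
      (h1 ▸ hs.hasSum)
    have h3 := congrFun h2 y
    exact (mul_eq_zero.1 h3).resolve_left (by simpa using hy)
  have hprop : ∀ n x y, h x = 0 → 0 < nStepRate p n x y → h y = 0 := by
    intro n
    induction n with
    | zero =>
      intro x y hx hn
      rw [nStepRate] at hn
      split_ifs at hn with hxy
      · rwa [← hxy]
      · exact absurd hn (lt_irrefl _)
    | succ n ih =>
      intro x y hx hn
      rw [nStepRate] at hn
      obtain ⟨z, hz⟩ := not_forall.1 (mt ENNReal.tsum_eq_zero.2 hn.ne')
      obtain ⟨hz1, hz2⟩ := mul_ne_zero_iff.1 hz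
      exact ih z y (hstep x hx z (by simpa using hz1)) (pos_iff_ne_zero.2 hz2)
  obtain ⟨n, hn⟩ := hp.irreducible o x
  exact hprop n o x (survivalLim_origin_eq_zero hp hc hrec) hn

end Functionals

/-! ### Long-time limits -/

section Limits

variable {V : Type*} [DecidableEq V]

lemma IsFlow.eq_zero {S J : Type*} {a : S → J → ℝ} {τ : S → J → S} {k : S → ℝ} {R : ℝ}
    {u : ℝ → S → ℝ} (ha : IsBoundedRates a R) (hk : ∀ x, 0 ≤ k x) (hu : IsFlow a τ k u)
    (h0 : ∀ x, u 0 x = 0) {t : ℝ} (ht : 0 ≤ t) (x : S) : u t x = 0 := by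
  have h1 := hu.nonneg ha hk (fun x => (h0 x).ge) ht x
  have h2 := (hu.linear ha hu (-1) 0).nonneg ha hk (fun x => by simp [h0 x]) ht x
  linarith

lemma tsum_moveRate_singleton {p : V → V → ℝ≥0} (hp : IsWalkRates p) (x : V) {F : Finset V → ℝ}
    {C : ℝ} (hF : ∀ B, |F B| ≤ C) :
    ∑' e, moveRate p {x} e * (F (moveSet {x} e) - F {x}) =
      ∑' y, (p x y : ℝ) * (F {y} - F {x}) := by
  rw [tsum_moveRate hp {x} (F := fun B => F B - F {x}) (C := C + C)
    fun B => (abs_sub _ _).trans (add_le_add (hF _) (hF _)), Finset.sum_singleton]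
  refine tsum_congr fun y => ?_
  have e : ({x} : Finset V).erase x = ∅ := by simp
  rw [e]
  by_cases hy : y = x
  · simp [hy]
  · simp [hy]

/-- The jumps suppressed by exclusion are those between two sites of A; their contributions
p(x,y)(v_y - v_x) are antisymmetric and cancel. So the exclusion generator acts on ∑_{x ∈ A} v_x as
that of independent walks. -/
lemma tsum_moveRate_sum {p : V → V → ℝ≥0} (hp : IsWalkRates p) (A : Finset V) {v : V → ℝ}
    {C : ℝ} (hv : ∀ x, |v x| ≤ C) :
    ∑' e, moveRate p A e * (∑ x ∈ moveSet A e, v x - ∑ x ∈ A, v x) =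
      ∑ x ∈ A, ∑' y, (p x y : ℝ) * (v y - v x) := by
  have hd : ∀ x y, |v y - v x| ≤ C + C := fun x y => (abs_sub _ _).trans (add_le_add (hv _) (hv _))
  have hterm : ∀ e, moveRate p A e * (∑ x ∈ moveSet A e, v x - ∑ x ∈ A, v x) =
      moveRate p A e * (v e.2 - v e.1) := by
    intro e
    by_cases h : e.1 ∈ A ∧ e.2 ∉ A
    · rw [moveSet, if_pos h, Finset.sum_insert fun h' => h.2 (Finset.mem_of_mem_erase h'),
        ← Finset.add_sum_erase A v h.1]
      ring
    · simp [moveRate, h]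
  have hs : Summable fun e => moveRate p A e * (v e.2 - v e.1) := by
    refine Summable.of_norm_bounded ((summable_moveRate hp A).mul_right (C + C)) fun e => ?_
    rw [Real.norm_eq_abs, abs_mul, abs_of_nonneg (moveRate_nonneg p A e)]
    exact mul_le_mul_of_nonneg_left (hd _ _) (moveRate_nonneg p A e)
  have hfull : ∀ x, Summable fun y => (p x y : ℝ) * (v y - v x) := fun x =>
    hp.isBoundedRates.summable_mul (hd x) x
  simp_rw [hterm]
  rw [tsum_prod_of_support (A := A) hs fun x hx y => by simp [moveRate, hx]]
  have hsplit : ∀ x ∈ A, ∑' y, moveRate p A (x, y) * (v y - v x) =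
      ∑' y, (p x y : ℝ) * (v y - v x) - ∑ y ∈ A, (p x y : ℝ) * (v y - v x) := by
    intro x hx
    have h1 : ∑' y, (if y ∈ A then (p x y : ℝ) * (v y - v x) else 0) =
        ∑ y ∈ A, (p x y : ℝ) * (v y - v x) := by
      rw [tsum_eq_sum (s := A) fun y hy => by simp [hy]]
      exact Finset.sum_congr rfl fun y hy => by simp [hy]
    have h2 : Summable fun y => if y ∈ A then (p x y : ℝ) * (v y - v x) else 0 :=
      summable_of_ne_finset_zero (s := A) fun y hy => by simp [hy]
    rw [← h1, ← (hfull x).tsum_sub h2]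
    refine tsum_congr fun y => ?_
    by_cases hy : y ∈ A <;> simp [moveRate, hx, hy]
  rw [Finset.sum_congr rfl hsplit, Finset.sum_sub_distrib]
  have hanti : ∑ x ∈ A, ∑ y ∈ A, (p x y : ℝ) * (v y - v x) = 0 := by
    have h1 : ∑ x ∈ A, ∑ y ∈ A, (p x y : ℝ) * (v y - v x) =
        -∑ x ∈ A, ∑ y ∈ A, (p x y : ℝ) * (v y - v x) := by
      conv_rhs => rw [Finset.sum_comm]
      rw [← Finset.sum_neg_distrib]
      refine Finset.sum_congr rfl fun x _ => ?_
      rw [← Finset.sum_neg_distrib]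
      refine Finset.sum_congr rfl fun y _ => ?_
      rw [hp.symm y x]; ring
    linarith
  rw [hanti, sub_zero]

variable [Countable V] {p : V → V → ℝ≥0} {o : V} {θ : unitInterval} {c : ℝ≥0}
  {T : FellerSemigroup (Config V)}

omit [DecidableEq V] [Countable V] in
lemma expectAt_zero (π : ProbabilityMeasure (Config V)) (f : Config V → ℝ) :
    expectAt T π f 0 = ∫ η, f η ∂(π : Measure (Config V)) := by
  rw [expectAt, Real.toNNReal_zero, T.evolve_zero]

omit [DecidableEq V] [Countable V] in
lemma tendsto_integral_of_expectAt {π : ProbabilityMeasure (Config V)} {f : Config V → ℝ} {l : ℝ}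
    (h : Tendsto (expectAt T π f) atTop (𝓝 l)) :
    Tendsto (fun t => ∫ η, f η ∂(T.evolve π t : Measure (Config V))) atTop (𝓝 l) := by
  have := h.comp (NNReal.tendsto_coe_atTop.2 tendsto_id)
  simpa [Function.comp_def, expectAt] using this

/-- A single dual particle feels no exclusion and is the walk itself; this moves the flow from
one-point sets to V. -/
lemma isFlow_walk (hp : IsWalkRates p) (hT : HasGenerator T (reservoirGen p o θ c))
    (π : ProbabilityMeasure (Config V)) :
    IsFlow (fun x y => (p x y : ℝ)) (fun _ y => y) (fun x => (siteKill o c x : ℝ))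
      (fun t x => expectAt T π (dual θ {x}) t) := by
  have h := isFlow_expectAt_dual hp θ.2.1 θ.2.2 o c T hT π 1
  refine ⟨⟨1, fun t _ x => abs_expectAt_dual_le T π θ.2.1 θ.2.2 {x} t⟩,
    fun x => h.continuousOn ⟨{x}, rfl⟩, fun t ht x => ?_⟩
  convert! h.deriv t ht ⟨{x}, rfl⟩ using 1
  have h1 := tsum_moveRate_singleton hp x (F := fun B => expectAt T π (dual θ B) t)
    fun B => abs_expectAt_dual_le T π θ.2.1 θ.2.2 B t
  simp only [rateOp, moveParticles, h1, killRate, siteKill, Finset.mem_singleton, eq_comm (a := o)]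
  congr 2
  split_ifs <;> simp

/-- Existence of the limit started from a product measure, in terms of survival probabilities. -/
theorem exists_limit (hp : IsWalkRates p) (hT : HasGenerator T (reservoirGen p o θ c))
    (ρ : unitInterval) : ∃ m : ProbabilityMeasure (Config V),
      Tendsto (T.evolve (bernoulliProduct V ρ)) atTop (𝓝 m) ∧
      ∀ A : Finset V, ∫ η, dual θ A η ∂(m : Measure (Config V)) = ((ρ : ℝ) - θ) ^ A.card *
        survivalLim (fun (B : Particles V A.card) e => moveRate p B e) moveParticles
          (fun B => killRate o c B) ⟨A, rfl⟩ := by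
  refine exists_tendsto_of_integral_dual θ fun A => tendsto_integral_of_expectAt ?_
  refine (isFlow_expectAt_dual hp θ.2.1 θ.2.2 o c T hT (bernoulliProduct V ρ) A.card).tendsto
    (isBoundedRates_moveRate hp _) (fun B => killRate_nonneg o c B.1) (fun B => ?_) ⟨A, rfl⟩
  rw [expectAt_zero, integral_dual_bernoulliProduct, B.2]

omit [DecidableEq V] [Countable V] in
lemma occ_eq_dual (θ : ℝ) (η : Config V) (x : V) : occ η x = θ + dual θ {x} η := by
  simp [dual]

omit [DecidableEq V] [Countable V] in
lemma dual_empty (θ : ℝ) (η : Config V) : dual θ ∅ η = 1 := by simp [dual]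

lemma integral_occ (θ : ℝ) (μ : Measure (Config V)) [IsProbabilityMeasure μ] (x : V) :
    ∫ η, occ η x ∂μ = θ + ∫ η, dual θ {x} η ∂μ := by
  simp_rw [occ_eq_dual θ]
  have hi : Integrable (dual θ {x}) μ := integrable_continuous μ (dualMap θ {x})
  rw [integral_add (integrable_const θ) hi]
  simp

lemma covariance_occ (θ : ℝ) (μ : Measure (Config V)) [IsProbabilityMeasure μ] {x y : V}
    (hxy : x ≠ y) : covariance (fun η => occ η x) (fun η => occ η y) μ =
      ∫ η, dual θ {x, y} η ∂μ - (∫ η, dual θ {x} η ∂μ) * ∫ η, dual θ {y} η ∂μ := by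
  have hi : ∀ B, Integrable (dual θ B) μ := fun B => integrable_continuous μ (dualMap θ B)
  have hprod : ∀ η : Config V, dual θ {x, y} η = dual θ {x} η * dual θ {y} η := fun η => by
    simp [dual, Finset.prod_pair hxy]
  set a := ∫ η, dual θ {x} η ∂μ
  set b := ∫ η, dual θ {y} η ∂μ
  have h : ∀ η : Config V, (occ η x - (θ + a)) * (occ η y - (θ + b)) =
      dual θ {x, y} η - b * dual θ {x} η - a * dual θ {y} η + a * b := fun η => by
    rw [hprod, occ_eq_dual θ η x, occ_eq_dual θ η y]; ring
  have hx : ∫ η, occ η x ∂μ = θ + a := integral_occ θ μ x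
  have hy : ∫ η, occ η y ∂μ = θ + b := integral_occ θ μ y
  simp only [covariance, hx, hy, h]
  have i1 : Integrable (fun η => dual θ {x, y} η - b * dual θ {x} η) μ :=
    (hi _).sub ((hi _).const_mul b)
  have i2 : Integrable (fun η => dual θ {x, y} η - b * dual θ {x} η - a * dual θ {y} η) μ :=
    i1.sub ((hi _).const_mul a)
  rw [integral_add i2 (integrable_const _), integral_sub i1 ((hi _).const_mul a),
    integral_sub (hi _) ((hi _).const_mul b), integral_const_mul, integral_const_mul]
  simp only [integral_const, probReal_univ, one_smul]
  ring

variable [MeasurableSpace V] [MeasurableSingletonClass V]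

/-- Densities and covariances of the limit started from a product measure. -/
theorem exists_limit_walkFK (hp : IsWalkRates p) (hT : HasGenerator T (reservoirGen p o θ c))
    (ρ : unitInterval) : ∃ m : ProbabilityMeasure (Config V),
      Tendsto (T.evolve (bernoulliProduct V ρ)) atTop (𝓝 m) ∧
      (∀ x, Tendsto (fun t => ∫ η, occ η x
        ∂(T.evolve (bernoulliProduct V ρ) t : Measure (Config V))) atTop
        (𝓝 ((θ : ℝ) + ((ρ : ℝ) - θ) * walkFK p o c x))) ∧
      (∀ x, ∫ η, occ η x ∂(m : Measure (Config V)) = (θ : ℝ) + ((ρ : ℝ) - θ) * walkFK p o c x) ∧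
      (∀ x y, x ≠ y → covariance (fun η => occ η x) (fun η => occ η y) (m : Measure (Config V)) =
        ((ρ : ℝ) - θ) ^ 2 * (exclusionFK p o c x y - independentFK p o c x y)) := by
  obtain ⟨m, hm, hA⟩ := exists_limit hp hT ρ
  have h1 : ∀ x, Tendsto (fun t => ∫ η, dual θ {x} η
      ∂(T.evolve (bernoulliProduct V ρ) t : Measure (Config V))) atTop
      (𝓝 (((ρ : ℝ) - θ) * walkFK p o c x)) := fun x => by
    rw [walkFK_eq hp]
    refine tendsto_integral_of_expectAt ((isFlow_walk hp hT (bernoulliProduct V ρ)).tendsto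
      hp.isBoundedRates (fun _ => NNReal.coe_nonneg _) (fun x => ?_) x)
    rw [expectAt_zero, integral_dual_bernoulliProduct, Finset.card_singleton, pow_one]
  have h2 : ∀ x, ∫ η, dual θ {x} η ∂(m : Measure (Config V)) = ((ρ : ℝ) - θ) * walkFK p o c x :=
    fun x => tendsto_nhds_unique (tendsto_integral_dual hm θ {x}) (h1 x)
  refine ⟨m, hm, fun x => ?_, fun x => ?_, fun x y hxy => ?_⟩
  · simp_rw [integral_occ (θ : ℝ)]
    exact (h1 x).const_add _
  · rw [integral_occ (θ : ℝ), h2]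
  -- The particle number occurs in the type of the state, so replacing the cardinality of {x, y} by
  -- 2 needs a statement for general n.
  · have hcard : ∀ n (h : ({x, y} : Finset V).card = n), ((ρ : ℝ) - θ) ^ ({x, y} : Finset V).card *
        survivalLim (fun (B : Particles V ({x, y} : Finset V).card) e => moveRate p B e)
          moveParticles (fun B => killRate o c B) ⟨{x, y}, rfl⟩ =
        ((ρ : ℝ) - θ) ^ n * survivalLim (fun (B : Particles V n) e => moveRate p B e)
          moveParticles (fun B => killRate o c B) ⟨{x, y}, h⟩ := by
      rintro _ rfl; rfl
    rw [covariance_occ (θ : ℝ) _ hxy, h2, h2, hA, hcard 2 (Finset.card_pair hxy),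
      survivalLim_pair hp o c hxy, ← exclusionFK_eq hp, independentFK_eq hp]
    ring

omit [MeasurableSpace V] [MeasurableSingletonClass V] in
lemma integral_dirac_dual (θ : ℝ) (A : Finset V) (η : Config V) :
    ∫ ζ, dual θ A ζ ∂(diracConfig η : Measure (Config V)) = dual θ A η :=
  integral_dirac' _ _ (continuous_dual θ A).stronglyMeasurable

omit [MeasurableSpace V] [MeasurableSingletonClass V] in
lemma bernoulliProduct_one : bernoulliProduct V 1 = diracConfig (fullConfig V) := by
  refine ext_of_integral_dual 1 fun A => ?_
  rw [integral_dual_bernoulliProduct, integral_dirac_dual]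
  simp [dual, occ, fullConfig]

/-- In the recurrent case the expectations of nontrivial duality functions vanish in the limit. -/
theorem tendsto_expectAt_dual_zero (hp : IsWalkRates p) (hc : 0 < c) (hrec : IsRecurrent p)
    (hT : HasGenerator T (reservoirGen p o θ c)) (π : ProbabilityMeasure (Config V))
    {A : Finset V} (hA : A.Nonempty) : Tendsto (expectAt T π (dual θ A)) atTop (𝓝 0) := by
  have hB := hp.isBoundedRates
  have hk : ∀ x, 0 ≤ (siteKill o c x : ℝ) := fun x => NNReal.coe_nonneg _
  -- The difference of the densities started from the full and the empty configuration: a solution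
  -- of the killed walk equation with initial value (1 - θ) - (0 - θ) = 1, obtained from the given
  -- semigroup without constructing another one.
  set v : ℝ → V → ℝ := fun t x => 1 * expectAt T (diracConfig (fullConfig V)) (dual θ {x}) t +
    (-1) * expectAt T (diracConfig fun _ => false) (dual θ {x}) t with hv
  have hflow : IsFlow (fun x y => (p x y : ℝ)) (fun _ y => y) (fun x => (siteKill o c x : ℝ)) v :=
    (isFlow_walk hp hT _).linear hB (isFlow_walk hp hT _) 1 (-1)
  have hv0 : ∀ x, v 0 x = 1 := fun x => by
    simp only [hv]
    rw [expectAt_zero, expectAt_zero, integral_dirac_dual, integral_dirac_dual]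
    simp [dual, occ, fullConfig]
  have hvlim : ∀ x, Tendsto (fun t => v t x) atTop (𝓝 0) := fun x => by
    have := hflow.tendsto hB hk hv0 x
    rwa [survivalLim_eq_zero hp hc hrec, mul_zero] at this
  have hvnn : ∀ t, 0 ≤ t → ∀ x, 0 ≤ v t x := fun t ht x =>
    hflow.nonneg hB hk (fun x => by rw [hv0]; exact zero_le_one) ht x
  obtain ⟨C, hC⟩ := hflow.bounded
  have hu := isFlow_expectAt_dual hp θ.2.1 θ.2.2 o c T hT π A.card
  have hua := fun (B : Finset V) t => abs_expectAt_dual_le T π θ.2.1 θ.2.2 B t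
  have hWC : ∀ t, 0 ≤ t → ∀ B : Particles V A.card, |∑ x ∈ B.1, v t x| ≤ A.card * C :=
    fun t ht B => by
      refine (Finset.abs_sum_le_sum_abs _ _).trans ?_
      refine (Finset.sum_le_card_nsmul _ _ C fun x _ => hC t ht x).trans_eq ?_
      rw [B.2, nsmul_eq_mul]
  -- The sum over particles is a supersolution: the jump parts agree by `tsum_moveRate_sum`, and a
  -- set containing the origin is killed with its whole sum, which is at least the single term v(o).
  have hWop : ∀ t, 0 ≤ t → ∀ B : Particles V A.card,
      rateOp (fun (B : Particles V A.card) e => moveRate p B e) moveParticles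
        (fun B => killRate o c B) (fun B => ∑ x ∈ B.1, v t x) B ≤
      ∑ x ∈ B.1, rateOp (fun x y => (p x y : ℝ)) (fun _ y => y) (fun x => (siteKill o c x : ℝ))
        (v t) x := by
    intro t ht B
    have h1 := tsum_moveRate_sum hp B.1 (hC t ht)
    simp only [rateOp, moveParticles]
    rw [h1, Finset.sum_sub_distrib]
    refine sub_le_sub_left ?_ _
    by_cases ho : o ∈ B.1
    · rw [killRate, if_pos ho, Finset.sum_eq_single_of_mem o ho fun x _ hx => by
        simp [siteKill, hx]]
      simp only [siteKill, if_true]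
      exact mul_le_mul_of_nonneg_left
        (Finset.single_le_sum (f := v t) (fun x _ => hvnn t ht x) ho) c.2
    · rw [killRate, if_neg ho, zero_mul]
      refine (Finset.sum_eq_zero fun x hx => ?_).le
      have : x ≠ o := fun h => ho (h ▸ hx)
      simp [siteKill, this]
  -- With s = 1 and s = -1 this bounds |E D_A| by ∑_{x ∈ A} v. Initially the sum equals |A| ≥ 1,
  -- which is where nonemptiness enters.
  have key : ∀ s : ℝ, |s| ≤ 1 → ∀ t, 0 ≤ t →
      0 ≤ 1 * ∑ x ∈ A, v t x + s * expectAt T π (dual θ A) t := by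
    intro s hs t ht
    refine nonneg_of_supersolution (τ := moveParticles)
      (w := fun t (B : Particles V A.card) => 1 * ∑ x ∈ B.1, v t x + s * expectAt T π (dual θ B) t)
      (w' := fun t B => 1 * ∑ x ∈ B.1, rateOp (fun x y => (p x y : ℝ)) (fun _ y => y)
        (fun x => (siteKill o c x : ℝ)) (v t) x +
        s * rateOp (fun (B : Particles V A.card) e => moveRate p B e) moveParticles
          (fun B => killRate o c B) (fun B => expectAt T π (dual θ B) t) B)
      (C := A.card * C + 1) (isBoundedRates_moveRate hp A.card)
      (fun B => killRate_nonneg o c B.1) ?_ ?_ ?_ ?_ ?_ ht ⟨A, rfl⟩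
    · intro t ht B
      refine (abs_add_le _ _).trans (add_le_add ?_ ?_)
      · rw [one_mul]; exact hWC t ht B
      · rw [abs_mul]
        exact mul_le_one₀ hs (abs_nonneg _) (hua _ _)
    · intro B
      exact (continuousOn_const.mul (continuousOn_finsetSum _ fun x _ =>
        hflow.continuousOn x)).add (continuousOn_const.mul (hu.continuousOn B))
    · intro t ht B
      exact ((HasDerivWithinAt.fun_sum fun x _ => hflow.deriv t ht x).const_mul 1).add
        ((hu.deriv t ht B).const_mul s)
    · intro t ht B
      rw [rateOp_linear (isBoundedRates_moveRate hp A.card) (hWC t ht) (fun B => hua B.1 t)]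
      have := hWop t ht B
      linarith
    · intro B
      simp only [hv0, Finset.sum_const, B.2, nsmul_eq_mul, mul_one, one_mul]
      have h1 : (1 : ℝ) ≤ A.card := by exact_mod_cast hA.card_pos
      have h2 : |s * expectAt T π (dual θ B) 0| ≤ 1 := by
        rw [abs_mul]; exact mul_le_one₀ hs (abs_nonneg _) (hua _ _)
      linarith [(abs_le.1 h2).1]
  have hsum : Tendsto (fun t => ∑ x ∈ A, v t x) atTop (𝓝 0) := by
    simpa using tendsto_finsetSum A fun x _ => hvlim x
  refine squeeze_zero_norm' ?_ hsum
  filter_upwards [eventually_ge_atTop 0] with t ht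
  rw [Real.norm_eq_abs, abs_le]
  have h1 := key 1 (by simp) t ht
  have h2 := key (-1) (by simp) t ht
  constructor <;> linarith

/-- In the recurrent case the process converges to the product measure with the density of the
reservoir. -/
theorem tendsto_evolve_of_recurrent (hp : IsWalkRates p) (hc : 0 < c) (hrec : IsRecurrent p)
    (hT : HasGenerator T (reservoirGen p o θ c)) (π : ProbabilityMeasure (Config V)) :
    Tendsto (T.evolve π) atTop (𝓝 (bernoulliProduct V θ)) := by
  refine tendsto_of_integral_dual (θ : ℝ) fun A => ?_
  rw [integral_dual_bernoulliProduct, sub_self]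
  rcases A.eq_empty_or_nonempty with rfl | hA
  · simp [dual_empty]
  · rw [zero_pow hA.card_pos.ne']
    exact tendsto_integral_of_expectAt (tendsto_expectAt_dual_zero hp hc hrec hT π hA)

omit [MeasurableSpace V] [MeasurableSingletonClass V] in
/-- The product measure with the density of the reservoir is invariant. -/
theorem evolve_bernoulliProduct (hp : IsWalkRates p)
    (hT : HasGenerator T (reservoirGen p o θ c)) (t : ℝ≥0) :
    T.evolve (bernoulliProduct V θ) t = bernoulliProduct V θ := by
  refine ext_of_integral_dual (θ : ℝ) fun A => ?_
  rw [integral_dual_bernoulliProduct, sub_self]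
  rcases A.eq_empty_or_nonempty with rfl | hA
  · simp [dual_empty]
  · have h := (isFlow_expectAt_dual hp θ.2.1 θ.2.2 o c T hT (bernoulliProduct V θ) A.card).eq_zero
      (isBoundedRates_moveRate hp A.card) (fun B => killRate_nonneg o c B.1)
      (fun B => by
        rw [expectAt_zero, integral_dual_bernoulliProduct, sub_self, B.2,
          zero_pow hA.card_pos.ne']) t.2 ⟨A, rfl⟩
    rw [zero_pow hA.card_pos.ne', ← h]
    simp [expectAt]

end Limits

/-! ### Both generators as instances of the reservoir generator. -/

section Generators

variable {V : Type*} [DecidableEq V]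

lemma sourceGen_eq (p : V → V → ℝ≥0) (o : V) (lam : ℝ≥0) :
    sourceGen p o lam = reservoirGen p o ((1 : unitInterval) : ℝ) lam := by
  ext f η
  simp [sourceGen, reservoirGen]

/-- With c = λ + μ and θ = λ / c one has cθ = λ and c(1 - θ) = μ; positivity of μ makes c nonzero.
-/
lemma sourceSinkGen_eq (p : V → V → ℝ≥0) (o : V) (lam : ℝ≥0) {mu : ℝ≥0} (hmu : 0 < mu) :
    sourceSinkGen p o lam mu = reservoirGen p o (reservoirDensity lam mu : ℝ) (lam + mu) := by
  ext f η
  have h : (0 : ℝ) < (lam : ℝ) + mu := add_pos_of_nonneg_of_pos lam.2 hmu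
  have h1 : ((lam + mu : ℝ≥0) : ℝ) * (reservoirDensity lam mu : ℝ) = lam := by
    simp only [reservoirDensity, NNReal.coe_add]
    field_simp
  have h2 : ((lam + mu : ℝ≥0) : ℝ) * (1 - (reservoirDensity lam mu : ℝ)) = mu := by
    rw [mul_sub, h1, NNReal.coe_add]; ring
  rw [sourceSinkGen, reservoirGen, h1, h2]

end Generators

end SourceSink

/-! ### The main theorem. -/

open SourceSink in
theorem mainTheorem1 {V : Type*} [Countable V] [DecidableEq V] [MeasurableSpace V]
    [MeasurableSingletonClass V] (p : V → V → ℝ≥0) (hp : IsWalkRates p) (o : V)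
    (ρ : unitInterval) (lam : ℝ≥0) :
    -- Part I: source only
    (∀ T : FellerSemigroup (Config V), HasGenerator T (sourceGen p o lam) →
      (0 < lam → IsRecurrent p →
        Tendsto (T.evolve (bernoulliProduct V ρ)) atTop (𝓝 (diracConfig (fullConfig V))) ∧
        (∀ η : Config V,
          Tendsto (T.evolve (diracConfig η)) atTop (𝓝 (diracConfig (fullConfig V)))) ∧
        (∀ π : ProbabilityMeasure (Config V),
          (∀ t, T.evolve π t = π) ↔ π = diracConfig (fullConfig V))) ∧
      (IsTransient p →
        ∃ m : ProbabilityMeasure (Config V),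
          Tendsto (T.evolve (bernoulliProduct V ρ)) atTop (𝓝 m) ∧
          (∀ x, Tendsto
            (fun t => ∫ η, (1 - occ η x) ∂(T.evolve (bernoulliProduct V ρ) t : Measure (Config V)))
            atTop (𝓝 ((1 - (ρ : ℝ)) * walkFK p o lam x))) ∧
          (∀ x, ∫ η, (1 - occ η x) ∂(m : Measure (Config V)) =
            (1 - (ρ : ℝ)) * walkFK p o lam x) ∧
          (∀ x y, x ≠ y →
            covariance (fun η => occ η x) (fun η => occ η y) (m : Measure (Config V)) =
              (1 - (ρ : ℝ)) ^ 2 * (exclusionFK p o lam x y - independentFK p o lam x y)))) ∧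
    -- Part II: source and sink
    (∀ mu : ℝ≥0, 0 < mu →
      ∀ T : FellerSemigroup (Config V), HasGenerator T (sourceSinkGen p o lam mu) →
      (IsRecurrent p →
        Tendsto (T.evolve (bernoulliProduct V ρ)) atTop
          (𝓝 (bernoulliProduct V (reservoirDensity lam mu))) ∧
        (∀ η : Config V,
          Tendsto (T.evolve (diracConfig η)) atTop
            (𝓝 (bernoulliProduct V (reservoirDensity lam mu))))) ∧
      (IsTransient p →
        ∃ m : ProbabilityMeasure (Config V),
          Tendsto (T.evolve (bernoulliProduct V ρ)) atTop (𝓝 m) ∧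
          (∀ x, Tendsto
            (fun t => ∫ η, occ η x ∂(T.evolve (bernoulliProduct V ρ) t : Measure (Config V)))
            atTop (𝓝 ((reservoirDensity lam mu : ℝ) +
              ((ρ : ℝ) - reservoirDensity lam mu) * walkFK p o (lam + mu) x))) ∧
          (∀ x, ∫ η, occ η x ∂(m : Measure (Config V)) =
            (reservoirDensity lam mu : ℝ) +
              ((ρ : ℝ) - reservoirDensity lam mu) * walkFK p o (lam + mu) x) ∧
          (∀ x y, x ≠ y →
            covariance (fun η => occ η x) (fun η => occ η y) (m : Measure (Config V)) =
              ((ρ : ℝ) - reservoirDensity lam mu) ^ 2 *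
                (exclusionFK p o (lam + mu) x y - independentFK p o (lam + mu) x y)))) := by
  refine ⟨fun T hT => ?_, fun mu hmu T hT => ?_⟩
  · rw [sourceGen_eq] at hT
    refine ⟨fun hlam hrec => ?_, fun _ => ?_⟩
    · have h := fun π => tendsto_evolve_of_recurrent hp hlam hrec hT π
      rw [bernoulliProduct_one] at h
      refine ⟨h _, fun η => h _, fun π => ⟨fun hπ => ?_, ?_⟩⟩
      -- The convergence holds from every initial law; for an invariant one the orbit is constant,
      -- so the law equals the limit.
      · have h1 := h π
        rw [show T.evolve π = fun _ => π from funext hπ] at h1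
        exact tendsto_nhds_unique tendsto_const_nhds h1
      · rintro rfl t
        rw [← bernoulliProduct_one]
        exact evolve_bernoulliProduct hp hT t
    · obtain ⟨m, hm, h1, h2, h3⟩ := exists_limit_walkFK hp hT ρ
      have hocc : ∀ (μ : ProbabilityMeasure (Config V)) x,
          ∫ η, (1 - occ η x) ∂(μ : Measure (Config V)) =
            1 - ∫ η, occ η x ∂(μ : Measure (Config V)) := fun μ x => by
        have hi : Integrable (fun η => occ η x) (μ : Measure (Config V)) :=
          integrable_continuous _ ⟨_, continuous_occ x⟩
        rw [integral_sub (integrable_const _) hi]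
        simp
      refine ⟨m, hm, fun x => ?_, fun x => ?_, fun x y hxy => ?_⟩
      · simp_rw [hocc]
        convert (h1 x).const_sub 1 using 2
        simp only [Set.Icc.coe_one]
        ring
      · rw [hocc, h2]
        simp only [Set.Icc.coe_one]
        ring
      · rw [h3 x y hxy]
        simp only [Set.Icc.coe_one]
        ring
  · rw [sourceSinkGen_eq p o lam hmu] at hT
    have hc : 0 < lam + mu := add_pos_of_nonneg_of_pos bot_le hmu
    refine ⟨fun hrec => ?_, fun _ => exists_limit_walkFK hp hT ρ⟩
    exact ⟨tendsto_evolve_of_recurrent hp hc hrec hT _,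
      fun η => tendsto_evolve_of_recurrent hp hc hrec hT _⟩
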